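/- A (finite) hypergraph $H$ is a pair of a finite vertex set $V(H)$ and a set $E(H)\subseteq 2^{V(H)}$ of edges; put $\|H\| = |V(H)|+|E(H)|$. For $X\subseteq V(H)$, the hypergraph $H-X$ has the vertex set $V(H)\setminus X$ and the edge set $\{e\setminus X : e\in E(H)\}\setminus\{\emptyset\}$. A nest-set of $H$ is a non-empty set $s\subseteq V(H)$ such that $\{e\setminus s : e\in E(H),\ e\cap s\neq\emptyset\}$ is linearly ordered by $\subseteq$. For an integer $k\ge 0$, a $k$-NEO (nest-set elimination ordering) of $H$ is a finite sequence $(s_1,\dots,s_q)$ of sets of at most $k$ vertices such that, with $H_0=H$ and $H_i=H_{i-1}-s_i$, each $s_i$ is a nest-set of $H_{i-1}$ and $H_q$ is the empty hypergraph $(\emptyset,\emptyset)$. The nest-set width $\mathrm{nsw}(H)$ is the least $k$ for which $H$ has a $k$-NEO ($\infty$ if there is none, which happens only for $H=(\emptyset,\{\emptyset\})$). **Corollary 5.7.** The problem with instance a hypergraph $H$ and an integer $k\ge 0$, and with the question "is $\mathrm{nsw}(H)\le k$?", is fixed-parameter tractable when parameterized by $k$: some algorithm decides it within $f(k)\cdot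 N^{c}$ steps, where $f$ is a computable function, $c$ is a constant and $N$ is the length of the input. Moreover, there is an algorithm that, on input $(H,k)$, runs for at most $2^{O(k^2)}\cdot\mathrm{poly}(\|H\|)$ steps (to be read as $c\cdot 2^{ck^2}(\|H\|+1)^{c}$ for a constant $c$), outputs a $k$-NEO of $H$ if $\mathrm{nsw}(H)\le k$, and rejects otherwise. Here an algorithm is a program for a random access machine with unit-cost instructions (assignment, addition, truncated subtraction, halving, indexed load and store, tests and loops). Its input is the word that consists of $k$, $|V(H)|$, $|E(H)|$ and the characteristic vectors of $V(H)$ and of all edges, for arbitrary numberings of the vertices and of the edges; $N$ is the number of entries of this word. -/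

import Mathlib

universe u

/-! Nest-sets, nest-set elimination orderings and nest-set width of hypergraphs. -/

namespace Hypergraph

/-- The size `‖H‖ = |V(H)| + |E(H)|` of a finite hypergraph. -/
noncomputable def size {α : Type u} (H : Hypergraph α) : ℕ :=
  H.vertexSet.ncard + H.edgeSet.ncard

/-- The vertex induced subhypergraph `H[U]`, for `U ⊆ V(H)`: its vertex set is `U`, and its edges
are the non-empty sets `e ∩ U`. -/
def induce {α : Type u} (H : Hypergraph α) (U : Set α) : Hypergraph α where
  vertexSet := U
  edgeSet := {e ∩ U | e ∈ H.edgeSet} \ {∅}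
  subset_vertexSet_of_mem_edgeSet' := by
    rintro _ ⟨⟨e, _, rfl⟩, _⟩
    exact Set.inter_subset_right

/-- Vertex deletion `H - X = H[V(H) \ X]`. -/
def delete {α : Type u} (H : Hypergraph α) (X : Set α) : Hypergraph α :=
  H.induce (H.vertexSet \ X)

/-- The edges incident to a set `s` of vertices, that is, to a vertex in `s`. -/
def incident {α : Type u} (H : Hypergraph α) (s : Set α) : Set (Set α) :=
  {e ∈ H.edgeSet | ∃ v ∈ s, v ∈ e}

/-- A nest-set: a non-empty set `s` of vertices such that the sets `e \ s`, for the edges `e`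
incident to `s`, are linearly ordered by `⊆`. -/
def IsNestSet {α : Type u} (H : Hypergraph α) (s : Set α) : Prop :=
  s.Nonempty ∧ s ⊆ H.vertexSet ∧ IsChain (· ⊆ ·) {d : Set α | ∃ e ∈ H.incident s, d = e \ s}

/-- A nest-set elimination ordering: successive deletion of nest-sets of the current hypergraph,
down to the empty hypergraph `⊥`, which has neither vertices nor edges. -/
def IsNEO {α : Type u} : Hypergraph α → List (Set α) → Prop
  | H, [] => H = ⊥
  | H, s :: O => H.IsNestSet s ∧ (H.delete s).IsNEO O

/-- A `k`-NEO: a nest-set elimination ordering all of whose sets have at most `k` elements. -/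
def IsKNEO {α : Type u} (H : Hypergraph α) (k : ℕ) (O : List (Set α)) : Prop :=
  H.IsNEO O ∧ ∀ s ∈ O, s.encard ≤ k

/-- The nest-set width, the least `k` for which there is a `k`-NEO. (It is `⊤` if there is none
for any `k`; for finite `H` this happens only if `V(H) = ∅` and `E(H) = {∅}`.) -/
noncomputable def nsw {α : Type u} (H : Hypergraph α) : ℕ∞ :=
  sInf {w : ℕ∞ | ∃ k : ℕ, w = k ∧ ∃ O, H.IsKNEO k O}

end Hypergraph

/-! Random access machines, with structured control flow. -/

namespace RAM

/-- A program for a random access machine with registers `0, 1, 2, …` and with memory arrays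
`0, 1, 2, …`; every register and every array cell holds a natural number. The names of registers
and arrays in a program are fixed, so that a program uses finitely many of them; the position
within an array is computed at run time. -/
inductive Prog : Type
  /-- do nothing -/
  | skip
  /-- `Rx := c` -/
  | const (x c : ℕ)
  /-- `Rx := Ry` -/
  | move (x y : ℕ)
  /-- `Rx := Ry + Rz` -/
  | add (x y z : ℕ)
  /-- `Rx := max (Ry - Rz) 0` -/
  | sub (x y z : ℕ)
  /-- `Rx := ⌊Ry / 2⌋` -/
  | half (x y : ℕ)
  /-- `Rx := Aa[Ry]` -/
  | load (x a y : ℕ)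
  /-- `Aa[Rx] := Ry` -/
  | store (a x y : ℕ)
  /-- first `p`, then `q` -/
  | seq (p q : Prog)
  /-- `p` if `Rx ≠ 0`, and `q` if `Rx = 0` -/
  | cond (x : ℕ) (p q : Prog)
  /-- repeat `p` as long as `Rx ≠ 0` -/
  | loop (x : ℕ) (p : Prog)

/-- The contents of the registers and of the arrays. -/
structure State : Type where
  reg : ℕ → ℕ
  arr : ℕ → ℕ → ℕ

/-- Assign the value `c` to the register `x`. -/
def State.setReg (σ : State) (x c : ℕ) : State :=
  { σ with reg := Function.update σ.reg x c }

/-- Assign the value `c` to the cell `i` of the array `a`. -/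
def State.setArr (σ : State) (a i c : ℕ) : State :=
  { σ with arr := Function.update σ.arr a (Function.update (σ.arr a) i c) }

/-- `Runs p σ t τ`: started in the state `σ`, the program `p` halts after exactly `t` steps, in the
state `τ`. Every elementary instruction and every test is one step. There is no multiplication,
so that `t` steps lengthen the binary expansion of a number by `O(t)` bits only. -/
inductive Runs : Prog → State → ℕ → State → Prop
  | skip (σ : State) : Runs .skip σ 1 σ
  | const (x c : ℕ) (σ : State) : Runs (.const x c) σ 1 (σ.setReg x c)
  | move (x y : ℕ) (σ : State) : Runs (.move x y) σ 1 (σ.setReg x (σ.reg y))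
  | add (x y z : ℕ) (σ : State) : Runs (.add x y z) σ 1 (σ.setReg x (σ.reg y + σ.reg z))
  | sub (x y z : ℕ) (σ : State) : Runs (.sub x y z) σ 1 (σ.setReg x (σ.reg y - σ.reg z))
  | half (x y : ℕ) (σ : State) : Runs (.half x y) σ 1 (σ.setReg x (σ.reg y / 2))
  | load (x a y : ℕ) (σ : State) : Runs (.load x a y) σ 1 (σ.setReg x (σ.arr a (σ.reg y)))
  | store (a x y : ℕ) (σ : State) : Runs (.store a x y) σ 1 (σ.setArr a (σ.reg x) (σ.reg y))
  | seq {p q : Prog} {σ τ ρ : State} {t s : ℕ} :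
      Runs p σ t τ → Runs q τ s ρ → Runs (.seq p q) σ (t + s) ρ
  | cond_pos {x : ℕ} {p q : Prog} {σ τ : State} {t : ℕ} :
      σ.reg x ≠ 0 → Runs p σ t τ → Runs (.cond x p q) σ (t + 1) τ
  | cond_zero {x : ℕ} {p q : Prog} {σ τ : State} {t : ℕ} :
      σ.reg x = 0 → Runs q σ t τ → Runs (.cond x p q) σ (t + 1) τ
  | loop_done {x : ℕ} {p : Prog} {σ : State} :
      σ.reg x = 0 → Runs (.loop x p) σ 1 σ
  | loop_step {x : ℕ} {p : Prog} {σ τ ρ : State} {t s : ℕ} :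
      σ.reg x ≠ 0 → Runs p σ t τ → Runs (.loop x p) τ s ρ → Runs (.loop x p) σ (t + s + 1) ρ

/-- Programs are deterministic: the number of steps and the final state are unique. -/
theorem Runs.unique {p : Prog} {σ τ τ₂ : State} {t t₂ : ℕ}
    (h : Runs p σ t τ) (h₂ : Runs p σ t₂ τ₂) : t = t₂ ∧ τ = τ₂ := by
  induction h generalizing t₂ τ₂ with
  | seq _ _ ih1 ih2 =>
    cases h₂ with
    | seq a b =>
      obtain ⟨rfl, rfl⟩ := ih1 a
      obtain ⟨rfl, rfl⟩ := ih2 b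
      exact ⟨rfl, rfl⟩
  | cond_pos hx _ ih =>
    cases h₂ with
    | cond_pos _ a => obtain ⟨rfl, rfl⟩ := ih a; exact ⟨rfl, rfl⟩
    | cond_zero hz _ => exact absurd hz hx
  | cond_zero hx _ ih =>
    cases h₂ with
    | cond_pos hz _ => exact absurd hx hz
    | cond_zero _ a => obtain ⟨rfl, rfl⟩ := ih a; exact ⟨rfl, rfl⟩
  | loop_done hx =>
    cases h₂ with
    | loop_done _ => exact ⟨rfl, rfl⟩
    | loop_step hz _ _ => exact absurd hx hz
  | loop_step hx _ _ ih1 ih2 =>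
    cases h₂ with
    | loop_done hz => exact absurd hz hx
    | loop_step _ a b =>
      obtain ⟨rfl, rfl⟩ := ih1 a
      obtain ⟨rfl, rfl⟩ := ih2 b
      exact ⟨rfl, rfl⟩
  | _ => cases h₂; exact ⟨rfl, rfl⟩

/-- The initial state for the input word `x`: the word stands in the array `0`, its length in the
register `0`, and everything else is zero. -/
def State.init (x : List ℕ) : State where
  reg := fun r => if r = 0 then x.length else 0
  arr := fun a i => if a = 0 then x.getD i 0 else 0

/-- The output word of a final state: it stands in the array `1`, its length in the
register `1`. -/
def State.output (τ : State) : List ℕ := (List.range (τ.reg 1)).map (τ.arr 1)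

/-- On the input word `x`, the program halts after exactly `t` steps with the output word `y`. -/
def Prog.Computes (p : Prog) (x : List ℕ) (t : ℕ) (y : List ℕ) : Prop :=
  ∃ τ : State, Runs p (State.init x) t τ ∧ τ.output = y

end RAM

/-! Parameterized decision problems. -/

/-- A parameterized decision problem, with the way in which its instances are presented to a
random access machine. -/
structure ParamProblem where
  Inst : Type u
  encode : Inst → List ℕ
  param : Inst → ℕ
  Yes : Inst → Prop

/-- Fixed-parameter tractability: there are a program, a computable function `f` and a constant `c`
such that the program halts on every instance `x` after at most `f (param x) * |x| ^ c` steps,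
with output `1` if `x` is a yes-instance and with output `0` otherwise. -/
def ParamProblem.IsFPT (P : ParamProblem.{u}) : Prop :=
  ∃ (p : RAM.Prog) (f : ℕ → ℕ) (c : ℕ), Computable f ∧
    ∀ x : P.Inst, ∃ (t : ℕ) (y : List ℕ), p.Computes (P.encode x) t y ∧
      t ≤ f (P.param x) * (P.encode x).length ^ c ∧
      (P.Yes x → y = [1]) ∧ (¬ P.Yes x → y = [0])

/-! The problem of deciding whether `nsw H ≤ k`. -/

/-- An instance: a finite hypergraph `H` and a number `k`, where `H` is presented by an arbitrary
numbering of its `n` vertices and an arbitrary numbering of its `m` edges. -/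
structure NSWInstance where
  α : Type u
  H : Hypergraph α
  n : ℕ
  m : ℕ
  vert : Fin n ≃ H.vertexSet
  edge : Fin m ≃ H.edgeSet
  k : ℕ

namespace NSWInstance

open Classical in
/-- The characteristic vector of a set of vertices, in the given numbering of the vertices. -/
noncomputable def charVec (x : NSWInstance.{u}) (s : Set x.α) : List ℕ :=
  List.ofFn (fun i => if (x.vert i : x.α) ∈ s then 1 else 0)

/-- The input word of an instance: the numbers `k`, `|V(H)|`, `|E(H)|`, the characteristic vector of
`V(H)`, and the characteristic vectors of the edges, one after the other. -/
noncomputable def encode (x : NSWInstance.{u}) : List ℕ :=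
  [x.k, x.n, x.m] ++ x.charVec x.H.vertexSet ++
    (List.ofFn (fun j => x.charVec (x.edge j : Set x.α))).flatten

/-- `x.Represents w O`: the word `w` describes the sequence `O` of sets of vertices. Each set is
written as a list of its elements, closed by a `0`; the vertex with the number `i` (numbers start
at `0`) is written as `i + 1`. -/
def Represents (x : NSWInstance.{u}) (w : List ℕ) (O : List (Set x.α)) : Prop :=
  ∃ L : List (List (Fin x.n)),
    w = (L.map (fun l => l.map (fun i => (i : ℕ) + 1) ++ [0])).flatten ∧
    O = L.map (fun l => {v : x.α | ∃ i ∈ l, v = x.vert i})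

end NSWInstance

/-- The problem with the instances `(H, k)`, the parameter `k` and the question `nsw H ≤ k`. -/
noncomputable def NSWProblem : ParamProblem.{u + 1} where
  Inst := NSWInstance.{u}
  encode := NSWInstance.encode
  param := NSWInstance.k
  Yes := fun x => x.H.nsw ≤ (x.k : ℕ∞)

/-! A language of `for`-programs with nested expressions, compiled to random access machines. -/

namespace ForLang

open RAM

/-! Two facts carry the proof. The first is that greedy elimination never goes wrong. If `s` is a
nest-set of `H`, then `s \ X`, when non-empty, is a nest-set of `H - X` (`IsNestSet.delete`). So if
`H` has a `k`-NEO and vertices remain outside `X`, the first set of the ordering that is not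
contained in `X` leaves behind a nest-set of `H - X` with at most `k` vertices
(`IsKNEO.exists_isNestSet_delete`). It is enough to delete small nest-sets as they are found; being
stuck with vertices left refutes `nsw H ≤ k`.

The second fact is that a small nest-set can be found by bounded branching. Let `S` be a non-empty
part of an unknown nest-set `s`, after the deletion of `D`. If two edges `e`, `f` meet `S` and are
incomparable outside `S ∪ D`, then, being comparable outside `s ∪ D`, they force `e \ (f ∪ D)` or `f
\ (e ∪ D)` into `s`. Adding the right one enlarges `S` inside `s`, so fewer than `k` binary choices
lead from one vertex to a nest-set inside `s` (`guided_step`, `search_complete`). All start vertices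
and all words of `k` bits are tried. Any candidate without a bad pair is a nest-set, whatever
choices produced it (`search_sound`).

The algorithm uses only `for`-loops bounded by `n`, `m`, `k` and `2 ^ k`. In a language of such
loops the time is polynomial in the largest bound (`cost_le`), hence `2 ^ O(k)` times a polynomial
in `‖H‖`, which is better than required. Compilation to the machine preserves meaning and cost
(`runs_compile`). -/

@[simp]
theorem _root_.RAM.State.reg_setReg (σ : State) (x c r : ℕ) :
    (σ.setReg x c).reg r = if r = x then c else σ.reg r := by
  simp [State.setReg, Function.update_apply]

@[simp]
theorem _root_.RAM.State.arr_setReg (σ : State) (x c : ℕ) : (σ.setReg x c).arr = σ.arr := rfl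

@[simp]
theorem _root_.RAM.State.reg_setArr (σ : State) (a i c : ℕ) : (σ.setArr a i c).reg = σ.reg := rfl

@[simp]
theorem _root_.RAM.State.arr_setArr (σ : State) (a i c b j : ℕ) :
    (σ.setArr a i c).arr b j = if b = a ∧ j = i then c else σ.arr b j := by
  simp only [State.setArr, Function.update_apply]
  split_ifs <;> simp_all

/-- Expressions over registers and arrays. -/
inductive Expr : Type
  | var (r : ℕ)
  | const (c : ℕ)
  | add (a b : Expr)
  | sub (a b : Expr)
  | half (a : Expr)
  | load (a : ℕ) (e : Expr)

namespace Expr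

def eval : Expr → State → ℕ
  | var r, σ => σ.reg r
  | const c, _ => c
  | add a b, σ => a.eval σ + b.eval σ
  | sub a b, σ => a.eval σ - b.eval σ
  | half a, σ => a.eval σ / 2
  | load a e, σ => σ.arr a (e.eval σ)

/-- All registers of the expression are below `K`. -/
def regsBelow (K : ℕ) : Expr → Bool
  | var r => r < K
  | const _ => true
  | add a b => a.regsBelow K && b.regsBelow K
  | sub a b => a.regsBelow K && b.regsBelow K
  | half a => a.regsBelow K
  | load _ e => e.regsBelow K

/-- Machine code that leaves the value of the expression in the register `t`, with the registers
from `t` on as scratch space. -/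
def compile : Expr → ℕ → Prog
  | var r, t => .move t r
  | const c, t => .const t c
  | add a b, t => .seq (.seq (a.compile t) (b.compile (t + 1))) (.add t t (t + 1))
  | sub a b, t => .seq (.seq (a.compile t) (b.compile (t + 1))) (.sub t t (t + 1))
  | half a, t => .seq (a.compile t) (.half t t)
  | load a e, t => .seq (e.compile t) (.load t a t)

def cost : Expr → ℕ
  | var _ => 1
  | const _ => 1
  | add a b => a.cost + b.cost + 1
  | sub a b => a.cost + b.cost + 1
  | half a => a.cost + 1
  | load _ e => e.cost + 1

end Expr

/-- The machine state `τ` agrees with `σ` on all arrays and on the registers below `K`. -/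
def Agree (K : ℕ) (σ τ : State) : Prop :=
  (∀ r < K, τ.reg r = σ.reg r) ∧ τ.arr = σ.arr

/-- Evaluation changes no register below `t`. Hence the first operand, left in `t`, survives the
evaluation of the second one in `t + 1`, and the variables below `K` stay intact. -/
theorem Expr.runs_compile {K : ℕ} (e : Expr) (he : e.regsBelow K = true) {σ τ : State} {t : ℕ}
    (ht : K ≤ t) (h : Agree K σ τ) :
    ∃ τ', Runs (e.compile t) τ e.cost τ' ∧ τ'.arr = τ.arr ∧ (∀ r < t, τ'.reg r = τ.reg r) ∧
      τ'.reg t = e.eval σ := by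
  induction e generalizing τ t with
  | var r =>
    simp only [regsBelow, decide_eq_true_eq] at he
    refine ⟨_, .move _ _ _, rfl, fun r' hr => ?_, ?_⟩
    · simp [hr.ne]
    · simp [h.1 r he, eval]
  | const c =>
    refine ⟨_, .const _ _ _, rfl, fun r' hr => ?_, ?_⟩
    · simp [hr.ne]
    · simp [eval]
  | add a b iha ihb =>
    simp only [regsBelow, Bool.and_eq_true] at he
    obtain ⟨τ₁, r₁, a₁, f₁, v₁⟩ := iha he.1 ht h
    have h₁ : Agree K σ τ₁ := ⟨fun r hr => (f₁ r (by omega)).trans (h.1 r hr), a₁.trans h.2⟩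
    obtain ⟨τ₂, r₂, a₂, f₂, v₂⟩ := ihb he.2 (show K ≤ t + 1 by omega) h₁
    refine ⟨_, .seq (.seq r₁ r₂) (.add _ _ _ _), a₂.trans a₁, fun r' hr => ?_, ?_⟩
    · simp [hr.ne, f₂ r' (by omega), f₁ r' hr]
    · simp [f₂ t (by omega), v₁, v₂, eval]
  | sub a b iha ihb =>
    simp only [regsBelow, Bool.and_eq_true] at he
    obtain ⟨τ₁, r₁, a₁, f₁, v₁⟩ := iha he.1 ht h
    have h₁ : Agree K σ τ₁ := ⟨fun r hr => (f₁ r (by omega)).trans (h.1 r hr), a₁.trans h.2⟩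
    obtain ⟨τ₂, r₂, a₂, f₂, v₂⟩ := ihb he.2 (show K ≤ t + 1 by omega) h₁
    refine ⟨_, .seq (.seq r₁ r₂) (.sub _ _ _ _), a₂.trans a₁, fun r' hr => ?_, ?_⟩
    · simp [hr.ne, f₂ r' (by omega), f₁ r' hr]
    · simp [f₂ t (by omega), v₁, v₂, eval]
  | half a iha =>
    obtain ⟨τ₁, r₁, a₁, f₁, v₁⟩ := iha he ht h
    refine ⟨_, .seq r₁ (.half _ _ _), a₁, fun r' hr => ?_, ?_⟩
    · simp [hr.ne, f₁ r' hr]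
    · simp [v₁, eval]
  | load a e ih =>
    obtain ⟨τ₁, r₁, a₁, f₁, v₁⟩ := ih he ht h
    refine ⟨_, .seq r₁ (.load _ _ _ _), a₁, fun r' hr => ?_, ?_⟩
    · simp [hr.ne, f₁ r' hr]
    · simp [v₁, eval, a₁, h.2]

/-- Commands. The command `forLt i b p` executes `p` with `i = 0, 1, …, Rb - 1`. -/
inductive Cmd : Type
  | skip
  | assign (x : ℕ) (e : Expr)
  | store (a : ℕ) (e₁ e₂ : Expr)
  | seq (p q : Cmd)
  | ite (e : Expr) (p q : Cmd)
  | forLt (i b : ℕ) (p : Cmd)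

namespace Cmd

def sem : Cmd → State → State
  | skip, σ => σ
  | assign x e, σ => σ.setReg x (e.eval σ)
  | store a e₁ e₂, σ => σ.setArr a (e₁.eval σ) (e₂.eval σ)
  | seq p q, σ => q.sem (p.sem σ)
  | ite e p q, σ => if e.eval σ ≠ 0 then p.sem σ else q.sem σ
  | .forLt i b p, σ =>
    Nat.rec (σ.setReg i 0) (fun j ρ => (p.sem ρ).setReg i (j + 1)) (σ.reg b)

/-- The command may write the register `r`. -/
def writes : Cmd → ℕ → Bool
  | skip, _ => false
  | assign x _, r => x == r
  | store _ _ _, _ => false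
  | seq p q, r => p.writes r || q.writes r
  | ite _ p q, r => p.writes r || q.writes r
  | .forLt i _ p, r => i == r || p.writes r

/-- The command may write the array `a`. -/
def writesArr : Cmd → ℕ → Bool
  | skip, _ => false
  | assign _ _, _ => false
  | store a _ _, b => a == b
  | seq p q, b => p.writesArr b || q.writesArr b
  | ite _ p q, b => p.writesArr b || q.writesArr b
  | .forLt _ _ p, b => p.writesArr b

/-- All registers are below `K`, those in `R` are never written, and the loops are bounded by
registers in `R` and leave their counters alone. -/
def wf (K : ℕ) (R : List ℕ) : Cmd → Bool
  | skip => true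
  | assign x e => decide (x < K) && decide (x ∉ R) && e.regsBelow K
  | store _ e₁ e₂ => e₁.regsBelow K && e₂.regsBelow K
  | seq p q => p.wf K R && q.wf K R
  | ite e p q => e.regsBelow K && p.wf K R && q.wf K R
  | .forLt i b p => decide (i < K) && decide (i ∉ R) && decide (b < K) && decide (b ∈ R) &&
      !p.writes i && p.wf K R

/-- In a loop, register `K` holds the number of remaining rounds at each test; the body may destroy
it, so it is recomputed. The code rereads the bound in every round while `sem` reads it once; they
agree because `wf` forbids writing it. -/
def compile (K : ℕ) : Cmd → Prog
  | skip => .skip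
  | assign x e => .seq (e.compile K) (.move x K)
  | store a e₁ e₂ => .seq (.seq (e₁.compile K) (e₂.compile (K + 1))) (.store a K (K + 1))
  | seq p q => .seq (p.compile K) (q.compile K)
  | ite e p q => .seq (e.compile K) (.cond K (p.compile K) (q.compile K))
  | .forLt i b p => .seq (.seq (.const i 0) (.sub K b i))
      (.loop K (.seq (.seq (.seq (p.compile K) (.const K 1)) (.add i i K)) (.sub K b i)))

/-- A bound for the running time if all loop bounds are at most `B`. -/
def cost (B : ℕ) : Cmd → ℕ
  | skip => 1
  | assign _ e => e.cost + 1
  | store _ e₁ e₂ => e₁.cost + e₂.cost + 1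
  | seq p q => p.cost B + q.cost B
  | ite e p q => e.cost + (p.cost B + q.cost B + 1)
  | .forLt _ _ p => B * (p.cost B + 4) + 3

/-- Polynomially bounded functions are closed under sums, and a loop multiplies by at most `B + 1`,
which raises the exponent by one. -/
theorem cost_le (p : Cmd) : ∃ C d : ℕ, ∀ B, p.cost B ≤ C * (B + 1) ^ d := by
  have hseq : ∀ f g : ℕ → ℕ, (∃ C d : ℕ, ∀ B, f B ≤ C * (B + 1) ^ d) →
      (∃ C d : ℕ, ∀ B, g B ≤ C * (B + 1) ^ d) → ∃ C d : ℕ, ∀ B, f B + g B ≤ C * (B + 1) ^ d := by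
    rintro f g ⟨C, d, hf⟩ ⟨C', d', hg⟩
    refine ⟨C + C', d + d', fun B => ?_⟩
    have h1 : (B + 1) ^ d ≤ (B + 1) ^ (d + d') := Nat.pow_le_pow_right (by omega) (by omega)
    have h2 : (B + 1) ^ d' ≤ (B + 1) ^ (d + d') := Nat.pow_le_pow_right (by omega) (by omega)
    calc f B + g B ≤ C * (B + 1) ^ d + C' * (B + 1) ^ d' := add_le_add (hf B) (hg B)
      _ ≤ C * (B + 1) ^ (d + d') + C' * (B + 1) ^ (d + d') := by gcongr
      _ = _ := by ring
  have hconst : ∀ c : ℕ, ∃ C d : ℕ, ∀ B : ℕ, c ≤ C * (B + 1) ^ d := fun c => ⟨c, 0, by simp⟩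
  induction p with
  | skip => exact hconst _
  | assign x e => exact hconst _
  | store a e₁ e₂ => exact hconst _
  | seq p q ihp ihq => exact hseq _ _ ihp ihq
  | ite e p q ihp ihq =>
    exact hseq _ _ (hconst _) (hseq _ _ (hseq _ _ ihp ihq) (hconst 1))
  | forLt i b p ih =>
    refine hseq _ _ ?_ (hconst 3)
    obtain ⟨C, d, h⟩ := hseq _ _ ih (hconst 4)
    refine ⟨C, d + 1, fun B => ?_⟩
    calc B * (p.cost B + 4) ≤ (B + 1) * (C * (B + 1) ^ d) := Nat.mul_le_mul (by omega) (h B)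
      _ = _ := by ring

theorem sem_reg (p : Cmd) (σ : State) {r : ℕ} (h : p.writes r = false) :
    (p.sem σ).reg r = σ.reg r := by
  induction p generalizing σ with
  | skip => rfl
  | assign x e =>
    have : r ≠ x := by rintro rfl; simp [writes] at h
    simp [sem, this]
  | store a e₁ e₂ => rfl
  | seq p q ihp ihq =>
    simp only [writes, Bool.or_eq_false_iff] at h
    rw [sem, ihq _ h.2, ihp _ h.1]
  | ite e p q ihp ihq =>
    simp only [writes, Bool.or_eq_false_iff] at h
    rw [sem]
    split_ifs
    exacts [ihp _ h.1, ihq _ h.2]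
  | forLt i b p ih =>
    simp only [writes, Bool.or_eq_false_iff, beq_eq_false_iff_ne] at h
    rw [sem]
    induction σ.reg b with
    | zero => simp [h.1.symm]
    | succ j ihj => simp [h.1.symm, ih _ h.2]; exact ihj

theorem sem_arr (p : Cmd) (σ : State) {a : ℕ} (h : p.writesArr a = false) :
    (p.sem σ).arr a = σ.arr a := by
  induction p generalizing σ with
  | skip => rfl
  | assign x e => rfl
  | store b e₁ e₂ =>
    have : a ≠ b := by rintro rfl; simp [writesArr] at h
    simp [sem, State.setArr, this]
  | seq p q ihp ihq =>
    simp only [writesArr, Bool.or_eq_false_iff] at h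
    rw [sem, ihq _ h.2, ihp _ h.1]
  | ite e p q ihp ihq =>
    simp only [writesArr, Bool.or_eq_false_iff] at h
    rw [sem]
    split_ifs
    exacts [ihp _ h.1, ihq _ h.2]
  | forLt i b p ih =>
    simp only [writesArr] at h
    rw [sem]
    induction σ.reg b with
    | zero => rfl
    | succ j ihj => simp [ih _ h]; exact ihj

theorem wf.writes {K : ℕ} {R : List ℕ} {p : Cmd} (h : p.wf K R = true) {r : ℕ} (hr : r ∈ R) :
    p.writes r = false := by
  induction p with
  | skip => rfl
  | assign x e =>
    simp only [wf, Bool.and_eq_true, decide_eq_true_eq] at h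
    simp only [Cmd.writes, beq_eq_false_iff_ne]
    rintro rfl
    exact h.1.2 hr
  | store a e₁ e₂ => rfl
  | seq p q ihp ihq =>
    simp only [wf, Bool.and_eq_true] at h
    simp [Cmd.writes, ihp h.1, ihq h.2]
  | ite e p q ihp ihq =>
    simp only [wf, Bool.and_eq_true] at h
    simp [Cmd.writes, ihp h.1.2, ihq h.2]
  | forLt i b p ih =>
    simp only [wf, Bool.and_eq_true, decide_eq_true_eq] at h
    simp only [Cmd.writes, ih h.2, Bool.or_false, beq_eq_false_iff_ne]
    rintro rfl
    exact h.1.1.1.1.2 hr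

theorem runs_compile {K B : ℕ} {R : List ℕ} (p : Cmd) (hp : p.wf K R = true) {σ τ : State}
    (h : Agree K σ τ) (hB : ∀ r ∈ R, σ.reg r ≤ B) :
    ∃ t τ', Runs (p.compile K) τ t τ' ∧ t ≤ p.cost B ∧ Agree K (p.sem σ) τ' := by
  induction p generalizing σ τ with
  | skip => exact ⟨1, τ, .skip _, le_rfl, h⟩
  | assign x e =>
    simp only [wf, Bool.and_eq_true, decide_eq_true_eq] at hp
    obtain ⟨τ₁, r₁, a₁, f₁, v₁⟩ := e.runs_compile hp.2 le_rfl h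
    refine ⟨_, _, .seq r₁ (.move _ _ _), le_rfl, fun r hr => ?_, a₁.trans h.2⟩
    simp only [sem, State.reg_setReg, v₁]
    split_ifs
    exacts [rfl, (f₁ r hr).trans (h.1 r hr)]
  | store a e₁ e₂ =>
    simp only [wf, Bool.and_eq_true] at hp
    obtain ⟨τ₁, r₁, a₁, f₁, v₁⟩ := e₁.runs_compile hp.1 le_rfl h
    have h₁ : Agree K σ τ₁ := ⟨fun r hr => (f₁ r hr).trans (h.1 r hr), a₁.trans h.2⟩
    obtain ⟨τ₂, r₂, a₂, f₂, v₂⟩ := e₂.runs_compile hp.2 (Nat.le_succ K) h₁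
    refine ⟨_, _, .seq (.seq r₁ r₂) (.store _ _ _ _), le_rfl, fun r hr => ?_, ?_⟩
    · exact (f₂ r (by omega)).trans (h₁.1 r hr)
    · simp [State.setArr, sem, f₂ K (by omega), v₁, v₂, a₂, a₁, h.2]
  | seq p q ihp ihq =>
    simp only [wf, Bool.and_eq_true] at hp
    obtain ⟨t₁, τ₁, r₁, l₁, h₁⟩ := ihp hp.1 h hB
    obtain ⟨t₂, τ₂, r₂, l₂, h₂⟩ := ihq hp.2 h₁
      fun r hr => by rw [sem_reg _ _ (wf.writes hp.1 hr)]; exact hB r hr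
    exact ⟨_, _, .seq r₁ r₂, add_le_add l₁ l₂, h₂⟩
  | ite e p q ihp ihq =>
    simp only [wf, Bool.and_eq_true] at hp
    obtain ⟨τ₁, r₁, a₁, f₁, v₁⟩ := e.runs_compile hp.1.1 le_rfl h
    have h₁ : Agree K σ τ₁ := ⟨fun r hr => (f₁ r hr).trans (h.1 r hr), a₁.trans h.2⟩
    by_cases he : e.eval σ = 0
    · obtain ⟨t, τ₂, r₂, l₂, h₂⟩ := ihq hp.2 h₁ hB
      refine ⟨_, _, .seq r₁ (.cond_zero (v₁.trans he) r₂), ?_, by simpa [sem, he] using h₂⟩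
      simp only [cost]; omega
    · obtain ⟨t, τ₂, r₂, l₂, h₂⟩ := ihp hp.1.2 h₁ hB
      refine ⟨_, _, .seq r₁ (.cond_pos (by rwa [v₁]) r₂), ?_, by simpa [sem, he] using h₂⟩
      simp only [cost]; omega
  | forLt i b p ih =>
    simp only [wf, Bool.and_eq_true, decide_eq_true_eq, Bool.not_eq_true'] at hp
    obtain ⟨⟨⟨⟨⟨hi, hiR⟩, hb⟩, hbR⟩, hpi⟩, hp⟩ := hp
    have hib : b ≠ i := by rintro rfl; exact hiR hbR
    have hbK : b ≠ K := hb.ne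
    have hiK : i ≠ K := hi.ne
    let S : ℕ → State := fun j =>
      Nat.rec (σ.setReg i 0) (fun j ρ => (p.sem ρ).setReg i (j + 1)) j
    have hS : ∀ j, (S j).reg i = j ∧ ∀ r ∈ R, (S j).reg r = σ.reg r := by
      intro j
      induction j with
      | zero =>
        refine ⟨by simp [S, State.setReg], fun r hr => ?_⟩
        have : r ≠ i := by rintro rfl; exact hiR hr
        simp [S, State.setReg, this]
      | succ j ihj =>
        refine ⟨by simp [S, State.setReg], fun r hr => ?_⟩
        have : r ≠ i := by rintro rfl; exact hiR hr
        change (((p.sem (S j)).setReg i (j + 1))).reg r = _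
        simp only [State.reg_setReg, this, if_false]
        rw [sem_reg _ _ (wf.writes hp hr), ihj.2 r hr]
    -- Induction on the number `d` of remaining rounds, the content of register `K`; `S j` is the
    -- state that the semantics prescribes after `j` rounds.
    have key : ∀ d j, j + d = σ.reg b → ∀ τ₁, Agree K (S j) τ₁ → τ₁.reg K = d →
        ∃ t τ', Runs (.loop K (.seq (.seq (.seq (p.compile K) (.const K 1)) (.add i i K))
          (.sub K b i))) τ₁ t τ' ∧ t ≤ d * (p.cost B + 4) + 1 ∧ Agree K (S (σ.reg b)) τ' := by
      intro d
      induction d with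
      | zero =>
        rintro j rfl τ₁ h₁ hd
        exact ⟨1, τ₁, .loop_done hd, by omega, h₁⟩
      | succ d ihd =>
        intro j hj τ₁ h₁ hd
        obtain ⟨t₂, τ₂, r₂, l₂, h₂⟩ := ih hp h₁ fun r hr => by rw [(hS j).2 r hr]; exact hB r hr
        have hi₂ : τ₂.reg i = j := by rw [h₂.1 i hi, sem_reg _ _ hpi, (hS j).1]
        have hb₂ : τ₂.reg b = σ.reg b := by
          rw [h₂.1 b hb, sem_reg _ _ (wf.writes hp hbR), (hS j).2 b hbR]
        have r₃ := Runs.seq (Runs.seq (Runs.seq r₂ (.const K 1 _)) (.add i i K _)) (.sub K b i _)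
        generalize hτ₃ : State.setReg _ K _ = τ₃ at r₃
        obtain ⟨t₄, τ₄, r₄, l₄, h₄⟩ := ihd (j + 1) (by omega) τ₃ (by
          subst hτ₃
          refine ⟨fun r hr => ?_, ?_⟩
          · have hrK : r ≠ K := hr.ne
            change _ = ((p.sem (S j)).setReg i (j + 1)).reg r
            simp only [State.reg_setReg, hrK, hiK, if_false, if_true, hi₂]
            rw [← h₂.1 r hr]
          · change _ = ((p.sem (S j)).setReg i (j + 1)).arr
            exact h₂.2) (by
          subst hτ₃
          simp only [State.reg_setReg, hbK, hib, hiK, if_false, if_true, hi₂,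
            hb₂]
          omega)
        -- A round costs four steps besides the body: the test and the three instructions that
        -- update the counter and register `K`.
        refine ⟨_, _, .loop_step (by omega) r₃ r₄, ?_, h₄⟩
        have : (d + 1) * (p.cost B + 4) = d * (p.cost B + 4) + (p.cost B + 4) := by ring
        omega
    have r₁ := Runs.seq (Runs.const i 0 τ) (.sub K b i _)
    generalize hτ₁ : State.setReg _ K _ = τ₁ at r₁
    obtain ⟨t₂, τ₂, r₂, l₂, h₂⟩ := key (σ.reg b) 0 (by omega) τ₁ (by
      subst hτ₁
      refine ⟨fun r hr => ?_, h.2⟩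
      have hrK : r ≠ K := hr.ne
      change _ = (σ.setReg i 0).reg r
      simp only [State.reg_setReg, hrK, if_false]
      rw [← h.1 r hr]) (by
      subst hτ₁
      simp [hib, h.1 b hb])
    refine ⟨_, _, .seq r₁ r₂, ?_, h₂⟩
    have : σ.reg b * (p.cost B + 4) ≤ B * (p.cost B + 4) := Nat.mul_le_mul_right _ (hB b hbR)
    simp only [cost]
    omega

/-- Induction along a loop; registers and arrays that the loop does not write may be used. -/
theorem forLt_induction {i b : ℕ} {p : Cmd} {σ : State}
    (I : ℕ → State → Prop) (h0 : I 0 (σ.setReg i 0))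
    (hs : ∀ j < σ.reg b, ∀ ρ : State, I j ρ → ρ.reg i = j →
      (∀ r, (Cmd.forLt i b p).writes r = false → ρ.reg r = σ.reg r) →
      (∀ a, p.writesArr a = false → ρ.arr a = σ.arr a) →
      I (j + 1) ((p.sem ρ).setReg i (j + 1))) :
    I (σ.reg b) ((Cmd.forLt i b p).sem σ) := by
  have : ∀ j ≤ σ.reg b, ∀ τ : State,
      τ = Nat.rec (σ.setReg i 0) (fun j ρ => (p.sem ρ).setReg i (j + 1)) j →
      I j τ ∧ τ.reg i = j ∧ (∀ r, (Cmd.forLt i b p).writes r = false → τ.reg r = σ.reg r) ∧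
      ∀ a, p.writesArr a = false → τ.arr a = σ.arr a := by
    intro j
    induction j with
    | zero =>
      rintro - τ rfl
      refine ⟨h0, by simp, fun r hr => ?_, fun a _ => rfl⟩
      simp only [writes, Bool.or_eq_false_iff, beq_eq_false_iff_ne] at hr
      simp [hr.1.symm]
    | succ j ih =>
      rintro hj τ rfl
      obtain ⟨h1, h2, h3, h4⟩ := ih (by omega) _ rfl
      refine ⟨hs j (by omega) _ h1 h2 h3 h4, by simp, fun r hr => ?_,
        fun a ha => ?_⟩
      · have hr' := hr
        simp only [writes, Bool.or_eq_false_iff, beq_eq_false_iff_ne] at hr'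
        simp only [State.reg_setReg, hr'.1.symm, if_false]
        rw [sem_reg _ _ hr'.2, h3 r hr]
      · exact (sem_arr _ _ ha).trans (h4 a ha)
  exact (this _ le_rfl _ rfl).1

end Cmd

end ForLang

/-! The search for a nest-set, as a computation with finite sets of numbers. -/

namespace NestSearch

open Finset

/-- The `n`-fold iteration of `g`, which may depend on the number of the iteration. -/
def iter {α : Type*} (g : ℕ → α → α) : ℕ → α → α
  | 0, s => s
  | n + 1, s => g n (iter g n s)

theorem iter_induction {α : Type*} {g : ℕ → α → α} {n : ℕ} {s : α} (I : ℕ → α → Prop)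
    (h0 : I 0 s) (hs : ∀ j < n, ∀ t, I j t → I (j + 1) (g j t)) : I n (iter g n s) := by
  induction n with
  | zero => exact h0
  | succ n ih => exact hs n (by omega) _ (ih fun j hj => hs j (by omega))

/-- The edges `e` and `f` are both incident to `S`, and they are incomparable outside of `S` and of
the deleted set `D`. -/
def Bad (E : ℕ → Finset ℕ) (D S : Finset ℕ) (e f : ℕ) : Prop :=
  (E e ∩ S).Nonempty ∧ (E f ∩ S).Nonempty ∧
    (E e \ (E f ∪ S ∪ D)).Nonempty ∧ (E f \ (E e ∪ S ∪ D)).Nonempty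

/-- `s` is a nest-set after the deletion of `D` in the hypergraph with the vertices `0, …, n - 1`
and the edges `E 0, …, E (m - 1)`. -/
def IsNest (E : ℕ → Finset ℕ) (n m : ℕ) (D s : Finset ℕ) : Prop :=
  s.Nonempty ∧ s ⊆ range n \ D ∧ ∀ e < m, ∀ f < m, ¬ Bad E D s e f

/-- The candidate set, the remaining binary choices, and a flag for the need of further passes. -/
abbrev Config := Finset ℕ × ℕ × ℕ

open Classical in
/-- Resolve an incomparable pair of edges in the way that the next binary choice prescribes. -/
noncomputable def step (E : ℕ → Finset ℕ) (D : Finset ℕ) (e f : ℕ) (c : Config) : Config :=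
  if Bad E D c.1 e f then
    (c.1 ∪ (if c.2.1 % 2 ≠ 0 then E e \ (E f ∪ D) else E f \ (E e ∪ D)), c.2.1 / 2, 1)
  else c

noncomputable def pass (E : ℕ → Finset ℕ) (D : Finset ℕ) (m : ℕ) (c : Config) : Config :=
  iter (fun e => iter (fun f => step E D e f) m) m c

/-- The flag is cleared before each pass, so at the end it tells about the last pass only. It starts
as `1`, so that for `k = 0` the search counts as failed. -/
noncomputable def search (E : ℕ → Finset ℕ) (D : Finset ℕ) (m k v b : ℕ) : Config :=
  iter (fun _ c => pass E D m (c.1, c.2.1, 0)) k ({v}, b, 1)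

variable {E : ℕ → Finset ℕ} {D : Finset ℕ} {n m k : ℕ}

/-- Incomparability outside `S ∪ D` provides a new vertex for either choice, so every resolution
strictly enlarges the candidate. Thus a pass without growth has met no bad pair and has tested all
pairs against the same set. -/
theorem pass_spec (E : ℕ → Finset ℕ) (D : Finset ℕ) (m : ℕ) (S : Finset ℕ) (b : ℕ) :
    (pass E D m (S, b, 0) = (S, b, 0) ∧ ∀ e < m, ∀ f < m, ¬ Bad E D S e f) ∨
    ((pass E D m (S, b, 0)).2.2 = 1 ∧ S.card < (pass E D m (S, b, 0)).1.card ∧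
      S ⊆ (pass E D m (S, b, 0)).1 ∧ ∃ e < m, ∃ f < m, Bad E D S e f) := by
  -- `Q` says that some resolution has taken place; it persists, because later steps only add
  -- vertices.
  let Q : Config → Prop := fun c =>
    c.2.2 = 1 ∧ S.card < c.1.card ∧ S ⊆ c.1 ∧ ∃ e < m, ∃ f < m, Bad E D S e f
  have hstep : ∀ c e f, e < m → f < m → (c = (S, b, 0) ∨ Q c) →
      (step E D e f c = (S, b, 0) ∧ ¬ Bad E D S e f) ∨ Q (step E D e f c) := by
    rintro c e f he hf (rfl | hQ)
    · by_cases hb : Bad E D S e f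
      · right
        have hsub : ∃ T : Finset ℕ, (step E D e f (S, b, 0)) = (S ∪ T, b / 2, 1) ∧
            (T \ S).Nonempty := by
          obtain ⟨-, -, ⟨x, hx⟩, ⟨y, hy⟩⟩ := id hb
          rw [step, if_pos hb]
          refine ⟨_, rfl, ?_⟩
          simp only [mem_sdiff, mem_union, not_or] at hx hy
          split_ifs
          · exact ⟨x, by simp [hx]⟩
          · exact ⟨y, by simp [hy]⟩
        obtain ⟨T, hT, x, hx⟩ := hsub
        rw [hT]
        refine ⟨rfl, card_lt_card ?_, subset_union_left, e, he, f, hf, hb⟩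
        rw [mem_sdiff] at hx
        exact ⟨subset_union_left, fun h => hx.2 (h (mem_union_right _ hx.1))⟩
      · left
        exact ⟨by rw [step, if_neg hb], hb⟩
    · right
      rw [step]
      by_cases hb : Bad E D c.1 e f
      · rw [if_pos hb]
        exact ⟨rfl, hQ.2.1.trans_le (card_le_card subset_union_left),
          hQ.2.2.1.trans subset_union_left, hQ.2.2.2⟩
      · rwa [if_neg hb]
  refine iter_induction (fun j c => (c = (S, b, 0) ∧ ∀ e < j, ∀ f < m, ¬ Bad E D S e f) ∨ Q c)
    (Or.inl ⟨rfl, by simp⟩) fun e he c hc => ?_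
  have := iter_induction (g := fun f => step E D e f) (n := m) (s := c)
    (fun j c' => (c' = (S, b, 0) ∧ (∀ e' < e, ∀ f < m, ¬ Bad E D S e' f) ∧
      ∀ f < j, ¬ Bad E D S e f) ∨ Q c') ?_ ?_
  · rcases this with ⟨h1, h2, h3⟩ | h
    · refine Or.inl ⟨h1, fun e' he' f hf => ?_⟩
      rcases Nat.lt_succ_iff_lt_or_eq.1 he' with h | rfl
      exacts [h2 e' h f hf, h3 f hf]
    · exact Or.inr h
  · rcases hc with h | h
    · exact Or.inl ⟨h.1, h.2, by simp⟩
    · exact Or.inr h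
  · intro f hf c' hc'
    rcases hstep c' e f he hf (hc'.imp_left And.left) with h | h
    · rcases hc' with hc' | hc'
      · refine Or.inl ⟨h.1, hc'.2.1, fun f' hf' => ?_⟩
        rcases Nat.lt_succ_iff_lt_or_eq.1 hf' with h' | rfl
        exacts [hc'.2.2 f' h', h.2]
      · right
        rwa [step, if_neg]
        intro hb
        have h1 := h.1
        rw [step, if_pos hb] at h1
        simp at h1
    · exact Or.inr h

/-- A pass that finds no bad pair changes nothing, so all later passes find none either; every other
pass adds a vertex to the single initial one. After `k` passes a raised flag therefore means more
than `k` vertices. -/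
theorem search_inv (E : ℕ → Finset ℕ) (D : Finset ℕ) (m k v b : ℕ) :
    v ∈ (search E D m k v b).1 ∧
      (((search E D m k v b).2.2 = 0 ∧ ∀ e < m, ∀ f < m, ¬ Bad E D (search E D m k v b).1 e f) ∨
        ((search E D m k v b).2.2 = 1 ∧ k + 1 ≤ (search E D m k v b).1.card)) := by
  refine iter_induction (fun j (c : Config) => v ∈ c.1 ∧ ((c.2.2 = 0 ∧ ∀ e < m, ∀ f < m, ¬ Bad E D c.1 e f) ∨
    (c.2.2 = 1 ∧ j + 1 ≤ c.1.card))) (by simp) ?_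
  rintro j hj ⟨S, b', w⟩ ⟨hv, hc⟩
  rcases pass_spec E D m S b' with h | h
  · dsimp only
    rw [h.1]
    exact ⟨hv, Or.inl ⟨rfl, h.2⟩⟩
  · refine ⟨h.2.2.1 hv, Or.inr ⟨h.1, ?_⟩⟩
    rcases hc with hc | hc
    · obtain ⟨e, he, f, hf, hb⟩ := h.2.2.2
      exact absurd hb (hc.2 e he f hf)
    · have := hc.2
      have := h.2.1
      dsimp only at *
      omega

theorem search_subset (hE : ∀ e < m, E e ⊆ range n) {v : ℕ} (hv : v < n) (hvD : v ∉ D) (b : ℕ) :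
    (search E D m k v b).1 ⊆ range n \ D := by
  refine iter_induction (fun _ (c : Config) => c.1 ⊆ range n \ D) (by simp [hv, hvD]) ?_
  intro _ _ c hc
  refine iter_induction (fun _ (c : Config) => c.1 ⊆ range n \ D) hc ?_
  intro e he c hc
  refine iter_induction (fun _ (c : Config) => c.1 ⊆ range n \ D) hc ?_
  intro f hf c hc
  rw [step]
  split_ifs
  · refine union_subset hc fun x hx => ?_
    have := @hE e he x
    simp only [mem_sdiff, mem_union] at *
    tauto
  · refine union_subset hc fun x hx => ?_
    have := @hE f hf x
    simp only [mem_sdiff, mem_union] at *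
    tauto
  · exact hc

theorem search_sound (hE : ∀ e < m, E e ⊆ range n) {v : ℕ} (hv : v < n) (hvD : v ∉ D) {b : ℕ}
    (h : (search E D m k v b).2.2 = 0) : IsNest E n m D (search E D m k v b).1 := by
  obtain ⟨h1, h2⟩ := search_inv E D m k v b
  refine ⟨⟨v, h1⟩, search_subset hE hv hvD b, ?_⟩
  rcases h2 with h2 | h2
  · exact h2.2
  · simp [h] at h2

/-- From any subset of `s`, some binary choices lead to a subset of `s`, and at most as many
choices are used up as vertices are added. -/
def Guided (s : Finset ℕ) (g : Config → Config) : Prop :=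
  ∀ S ⊆ s, ∀ w, ∃ S' ⊆ s, ∃ w' l c, l + S.card ≤ S'.card ∧ c < 2 ^ l ∧
    ∀ b, g (S, c + 2 ^ l * b, w) = (S', b, w')

/-- Choices are read from the lowest bit on, so consecutive stages concatenate their words: `c₁ + 2
^ l₁ * c₂`. -/
theorem Guided.iter {s : Finset ℕ} {g : ℕ → Config → Config} (h : ∀ j < n, Guided s (g j)) :
    Guided s (iter g n) := by
  induction n with
  | zero => exact fun S hS w => ⟨S, hS, w, 0, 0, by simp, by simp, fun b => by simp [NestSearch.iter]⟩
  | succ n ih =>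
    intro S hS w
    obtain ⟨S₁, hS₁, w₁, l₁, c₁, hl₁, hc₁, h₁⟩ := ih (fun j hj => h j (by omega)) S hS w
    obtain ⟨S₂, hS₂, w₂, l₂, c₂, hl₂, hc₂, h₂⟩ := h n (by omega) S₁ hS₁ w₁
    refine ⟨S₂, hS₂, w₂, l₁ + l₂, c₁ + 2 ^ l₁ * c₂, by omega, ?_, fun b => ?_⟩
    · calc c₁ + 2 ^ l₁ * c₂ < 2 ^ l₁ + 2 ^ l₁ * c₂ := by omega
        _ = 2 ^ l₁ * (c₂ + 1) := by ring
        _ ≤ 2 ^ l₁ * 2 ^ l₂ := Nat.mul_le_mul_left _ hc₂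
        _ = _ := (pow_add _ _ _).symm
    · have : c₁ + 2 ^ l₁ * c₂ + 2 ^ (l₁ + l₂) * b = c₁ + 2 ^ l₁ * (c₂ + 2 ^ l₂ * b) := by ring
      rw [NestSearch.iter, this, h₁, h₂]

/-- The branching argument: both edges meet `s` because they meet `S`, so one difference is empty
outside `s ∪ D`, and adding all of it to `S` stays within `s`. One bit is spent and at least one
vertex is gained. -/
theorem guided_step {s : Finset ℕ} (hs : IsNest E n m D s) {e f : ℕ} (he : e < m) (hf : f < m) :
    Guided s (step E D e f) := by
  intro S hS w
  by_cases hb : Bad E D S e f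
  · have hns := hs.2.2 e he f hf
    obtain ⟨h1, h2, ⟨x, hx⟩, ⟨y, hy⟩⟩ := id hb
    have h1' := h1.mono (inter_subset_inter_left hS : E e ∩ S ⊆ E e ∩ s)
    have h2' := h2.mono (inter_subset_inter_left hS : E f ∩ S ⊆ E f ∩ s)
    have key : ∀ T : Finset ℕ, ∀ z, z ∈ T → z ∉ S → 1 + S.card ≤ (S ∪ T).card := by
      intro T z hz hzS
      have : S ⊂ S ∪ T := ⟨subset_union_left, fun h => hzS (h (mem_union_right _ hz))⟩
      have := card_lt_card this
      omega
    simp only [mem_sdiff, mem_union, not_or] at hx hy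
    by_cases hef : (E e \ (E f ∪ s ∪ D)).Nonempty
    · have hfe : ¬ (E f \ (E e ∪ s ∪ D)).Nonempty := fun h => hns ⟨h1', h2', hef, h⟩
      rw [not_nonempty_iff_eq_empty, sdiff_eq_empty_iff_subset] at hfe
      -- One bit is used, `l = 1`, with value `0`, which selects `E f \ (E e ∪ D)`; the other case
      -- below needs the value `1`.
      refine ⟨S ∪ E f \ (E e ∪ D), union_subset hS fun z hz => ?_, 1, 1, 0,
        key _ y (by simp [hy]) hy.2.1.2, by simp, fun b => ?_⟩
      · have := @hfe z
        simp only [mem_sdiff, mem_union] at *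
        tauto
      · rw [step, if_pos hb]
        simp
    · rw [not_nonempty_iff_eq_empty, sdiff_eq_empty_iff_subset] at hef
      refine ⟨S ∪ E e \ (E f ∪ D), union_subset hS fun z hz => ?_, 1, 1, 1,
        key _ x (by simp [hx]) hx.2.1.2, by simp, fun b => ?_⟩
      · have := @hef z
        simp only [mem_sdiff, mem_union] at *
        tauto
      · rw [step, if_pos hb]
        simp [Nat.add_mod]
        omega
  · exact ⟨S, hS, w, 0, 0, by simp, by simp, fun b => by simp [step, hb]⟩

theorem search_complete {s : Finset ℕ} (hs : IsNest E n m D s) {v : ℕ} (hv : v ∈ s)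
    (hk : s.card ≤ k) :
    ∃ b < 2 ^ k, (search E D m k v b).2.2 = 0 ∧ (search E D m k v b).1.card ≤ k := by
  have hg : Guided s (iter (fun _ c => pass E D m (c.1, c.2.1, 0)) k) := by
    refine Guided.iter fun _ _ S hS w => ?_
    have : Guided s (pass E D m) := Guided.iter fun e he => Guided.iter fun f hf =>
      guided_step hs he hf
    exact this S hS 0
  obtain ⟨S, hS, w, l, c, hl, hc, h⟩ := hg {v} (by simpa using hv) 1
  have hcard := card_le_card hS
  -- The start set already has one vertex and the result stays inside `s`, so the word is short
  -- enough. A raised flag would need `k + 1` vertices inside `s`.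
  rw [card_singleton] at hl
  have hlk : l ≤ k := by omega
  have h0 := h 0
  rw [mul_zero, add_zero] at h0
  have h0' : search E D m k v c = (S, 0, w) := h0
  refine ⟨c, hc.trans_le (Nat.pow_le_pow_right (by omega) hlk), ?_⟩
  have := (search_inv E D m k v c).2
  rw [h0'] at this ⊢
  dsimp only at *
  omega

end NestSearch

/-! Nest-sets under vertex deletion. -/

namespace Hypergraph

variable {α : Type u} {H : Hypergraph α}

theorem delete_vertexSet (H : Hypergraph α) (X : Set α) :
    (H.delete X).vertexSet = H.vertexSet \ X := rfl

theorem mem_delete_edgeSet {X d : Set α} :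
    d ∈ (H.delete X).edgeSet ↔ d.Nonempty ∧ ∃ e ∈ H.edgeSet, d = e \ X := by
  have key : ∀ e ∈ H.edgeSet, e ∩ (H.vertexSet \ X) = e \ X := fun e he => by
    rw [← Set.inter_sdiff_assoc,
      Set.inter_eq_left.2 (H.subset_vertexSet_of_mem_edgeSet' he)]
  change (∃ e, e ∈ H.edgeSet ∧ e ∩ (H.vertexSet \ X) = d) ∧ d ≠ ∅ ↔ _
  rw [and_comm, Set.nonempty_iff_ne_empty]
  refine and_congr_right fun _ => exists_congr fun e => and_congr_right fun he => ?_
  rw [key e he, eq_comm]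

/-- Lets every intermediate hypergraph of an elimination be treated as `H` minus a single set. -/
theorem delete_delete (H : Hypergraph α) (X Y : Set α) :
    (H.delete X).delete Y = H.delete (X ∪ Y) := by
  refine Hypergraph.ext (Set.sdiff_sdiff) (Set.ext fun d => ?_)
  simp only [mem_delete_edgeSet]
  refine and_congr_right fun hd => ⟨?_, ?_⟩
  · rintro ⟨e, ⟨-, e', he', rfl⟩, rfl⟩
    exact ⟨e', he', Set.sdiff_sdiff⟩
  · rintro ⟨e, he, rfl⟩
    refine ⟨e \ X, ⟨?_, e, he, rfl⟩, Set.sdiff_sdiff.symm⟩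
    exact hd.mono (Set.sdiff_subset_sdiff_right Set.subset_union_left)

theorem isNestSet_iff {s : Set α} : H.IsNestSet s ↔ s.Nonempty ∧ s ⊆ H.vertexSet ∧
    ∀ e ∈ H.edgeSet, ∀ f ∈ H.edgeSet, (e ∩ s).Nonempty → (f ∩ s).Nonempty →
      e \ s ⊆ f ∨ f \ s ⊆ e := by
  have hinc : ∀ e, e ∈ H.incident s ↔ e ∈ H.edgeSet ∧ (e ∩ s).Nonempty := fun e =>
    and_congr_right fun _ => exists_congr fun v => and_comm
  have hsub : ∀ e f : Set α, e \ s ⊆ f \ s ↔ e \ s ⊆ f := fun e f =>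
    ⟨fun h => h.trans Set.sdiff_subset, fun h => Set.subset_sdiff.2 ⟨h, Set.disjoint_sdiff_left⟩⟩
  refine and_congr_right fun _ => and_congr_right fun _ => ⟨fun h e he f hf hes hfs => ?_,
    fun h => ?_⟩
  · have := h.total ⟨e, (hinc e).2 ⟨he, hes⟩, rfl⟩ ⟨f, (hinc f).2 ⟨hf, hfs⟩, rfl⟩
    simpa only [hsub] using this
  · rintro _ ⟨e, he, rfl⟩ _ ⟨f, hf, rfl⟩ -
    rw [hinc] at he hf
    simpa only [hsub] using h e he.1 f hf.1 he.2 hf.2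

/-- Expresses nest-sets of `H - X` by the edges of `H` itself. As `s` avoids `X`, an edge meets `s`
before the deletion exactly when it does so after it, and edges that become empty play no role. -/
theorem isNestSet_delete_iff {X s : Set α} : (H.delete X).IsNestSet s ↔
    s.Nonempty ∧ s ⊆ H.vertexSet \ X ∧
    ∀ e ∈ H.edgeSet, ∀ f ∈ H.edgeSet, (e ∩ s).Nonempty → (f ∩ s).Nonempty →
      e \ (X ∪ s) ⊆ f ∨ f \ (X ∪ s) ⊆ e := by
  rw [isNestSet_iff, delete_vertexSet]
  refine and_congr_right fun _ => and_congr_right fun hs => ?_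
  have hint : ∀ e : Set α, e \ X ∩ s = e ∩ s := fun e => by
    ext v
    have := @hs v
    simp only [Set.mem_inter_iff, Set.mem_sdiff] at *
    tauto
  have hsub : ∀ e f : Set α, (e \ X) \ s ⊆ f \ X ↔ e \ (X ∪ s) ⊆ f := fun e f => by
    rw [Set.sdiff_sdiff]
    exact ⟨fun h => h.trans Set.sdiff_subset, fun h => Set.subset_sdiff.2 ⟨h,
      Set.disjoint_sdiff_left.mono_right Set.subset_union_left⟩⟩
  constructor
  · intro h e he f hf hes hfs
    rw [← hint] at hes hfs
    have := h (e \ X) (mem_delete_edgeSet.2 ⟨hes.mono Set.inter_subset_left, e, he, rfl⟩)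
      (f \ X) (mem_delete_edgeSet.2 ⟨hfs.mono Set.inter_subset_left, f, hf, rfl⟩) hes hfs
    simpa only [hsub] using this
  · intro h d hd d' hd' hds hds'
    obtain ⟨-, e, he, rfl⟩ := mem_delete_edgeSet.1 hd
    obtain ⟨-, f, hf, rfl⟩ := mem_delete_edgeSet.1 hd'
    rw [hint] at hds hds'
    simpa only [hsub] using h e he f hf hds hds'

/-- Since `X ∪ s \ X` contains `s`, less of each edge remains to be compared, and any edge that
meets `s \ X` meets `s`. -/
theorem IsNestSet.delete {s X : Set α} (h : H.IsNestSet s) (hX : (s \ X).Nonempty) :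
    (H.delete X).IsNestSet (s \ X) := by
  rw [isNestSet_iff] at h
  rw [isNestSet_delete_iff]
  refine ⟨hX, Set.sdiff_subset_sdiff_left h.2.1, fun e he f hf hes hfs => ?_⟩
  have hsub : ∀ e : Set α, e \ (X ∪ s \ X) ⊆ e \ s := fun e =>
    Set.sdiff_subset_sdiff_right (by rw [Set.union_sdiff_self]; exact Set.subset_union_right)
  exact (h.2.2 e he f hf (hes.mono (Set.inter_subset_inter_right _ Set.sdiff_subset))
    (hfs.mono (Set.inter_subset_inter_right _ Set.sdiff_subset))).imp (hsub e).trans (hsub f).trans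

/-- Follow the ordering up to its first set not contained in `X`. The sets before it are absorbed by
`X`, so deleting them makes no difference to `H - X`. -/
theorem IsKNEO.exists_isNestSet_delete {k : ℕ} {O : List (Set α)} (hO : H.IsKNEO k O) {X : Set α}
    (hX : (H.vertexSet \ X).Nonempty) : ∃ s, (H.delete X).IsNestSet s ∧ s.encard ≤ k := by
  obtain ⟨hO, hk⟩ := hO
  induction O generalizing H with
  | nil =>
    rw [show H = ⊥ from hO] at hX
    obtain ⟨v, hv, -⟩ := hX
    exact absurd hv (Set.notMem_empty v)
  | cons s O ih =>
    by_cases hs : s ⊆ X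
    · obtain ⟨t, ht, htk⟩ := ih (H := H.delete s)
        (by rwa [delete_vertexSet, Set.sdiff_sdiff, Set.union_eq_self_of_subset_left hs]) hO.2
        fun t ht => hk t (List.mem_cons_of_mem _ ht)
      rw [delete_delete, Set.union_eq_self_of_subset_left hs] at ht
      exact ⟨t, ht, htk⟩
    · exact ⟨s \ X, hO.1.delete (Set.sdiff_nonempty.2 hs),
        (Set.encard_le_encard Set.sdiff_subset).trans (hk s List.mem_cons_self)⟩

/-- The sets in the list are successively eliminated as nest-sets, and they have the given union. -/
inductive PartialNEO (H : Hypergraph α) (k : ℕ) : List (Set α) → Set α → Prop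
  | nil : PartialNEO H k [] ∅
  | snoc {O : List (Set α)} {X s : Set α} : PartialNEO H k O X → (H.delete X).IsNestSet s →
      s.encard ≤ k → PartialNEO H k (O ++ [s]) (X ∪ s)

/-- The empty list is set apart because deleting `∅` still discards an empty edge, so `H.delete ∅`
may differ from `H`. -/
theorem PartialNEO.isNEO_append {k : ℕ} {O O' : List (Set α)} {X : Set α}
    (h : H.PartialNEO k O X)
    (hO' : (H.delete X).IsNEO O' ∧ O ≠ [] ∨ H.IsNEO O' ∧ O = []) : H.IsNEO (O ++ O') := by
  induction h generalizing O' with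
  | nil => simpa using hO'
  | @snoc O X s h hs hk ih =>
    have hO'' : (H.delete (X ∪ s)).IsNEO O' := by simpa using hO'
    rw [List.append_assoc]
    refine ih ?_
    by_cases hO : O = []
    · subst hO
      have hX : X = ∅ := by
        generalize hO : ([] : List (Set α)) = O at h
        cases h with
        | nil => rfl
        | snoc => simp at hO
      subst hX
      refine Or.inr ⟨⟨?_, ?_⟩, rfl⟩
      · rw [isNestSet_delete_iff] at hs
        rw [isNestSet_iff]
        simpa using hs
      · simpa using hO''
    · exact Or.inl ⟨⟨hs, by rwa [delete_delete]⟩, hO⟩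

theorem PartialNEO.isKNEO {k : ℕ} {O : List (Set α)} {X : Set α} (h : H.PartialNEO k O X)
    (hX : H.vertexSet ⊆ X) (hO : O ≠ [] ∨ H = ⊥) : H.IsKNEO k O := by
  have hk : ∀ s ∈ O, s.encard ≤ k := by
    clear hO hX
    induction h with
    | nil => simp
    | snoc h hs hk ih =>
      intro t ht
      rcases List.mem_append.1 ht with ht | ht
      · exact ih t ht
      · rwa [List.mem_singleton.1 ht]
  refine ⟨?_, hk⟩
  have hdel : H.delete X = ⊥ := by
    refine Hypergraph.ext (Set.sdiff_eq_empty.2 hX) (Set.eq_empty_iff_forall_notMem.2 fun d hd => ?_)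
    obtain ⟨hd, e, he, rfl⟩ := mem_delete_edgeSet.1 hd
    rw [Set.sdiff_eq_empty.2 ((H.subset_vertexSet_of_mem_edgeSet' he).trans hX)] at hd
    exact Set.not_nonempty_empty hd
  have := h.isNEO_append (O' := [])
  rw [List.append_nil] at this
  apply this
  by_cases hO' : O = []
  · exact Or.inr ⟨hO.resolve_left (not_not.2 hO'), hO'⟩
  · exact Or.inl ⟨hdel, hO'⟩

/-- The infimum of a non-empty set in `ℕ∞` is attained, and a `k'`-NEO is a `k`-NEO for every `k ≥
k'`; if there is no ordering, the infimum is `⊤`. -/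
theorem nsw_le_iff {k : ℕ} : H.nsw ≤ k ↔ ∃ O, H.IsKNEO k O := by
  constructor
  · intro h
    have hne : {w : ℕ∞ | ∃ k : ℕ, w = k ∧ ∃ O, H.IsKNEO k O}.Nonempty := by
      by_contra hne
      rw [Set.not_nonempty_iff_eq_empty] at hne
      rw [nsw, hne, sInf_empty] at h
      exact absurd h (by simp)
    obtain ⟨k', hk', O, hO⟩ := csInf_mem hne
    refine ⟨O, hO.1, fun s hs => (hO.2 s hs).trans ?_⟩
    rw [← hk']
    exact h
  · rintro ⟨O, hO⟩
    exact sInf_le ⟨k, rfl, O, hO⟩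

end Hypergraph

/-! ### Translation between sets of vertices and finite sets of numbers. -/

namespace NSWInstance

open Finset NestSearch

variable (x : NSWInstance.{u})

/-- The set of the vertices with numbers in `S`. -/
def toSet (S : Finset ℕ) : Set x.α := {v | ∃ i : Fin x.n, (i : ℕ) ∈ S ∧ v = x.vert i}

open Classical in
/-- The numbers of the vertices in `s`. -/
noncomputable def indices (s : Set x.α) : Finset ℕ :=
  (univ.filter fun i : Fin x.n => (x.vert i : x.α) ∈ s).map Fin.valEmbedding

open Classical in
noncomputable def edgeIndices (j : ℕ) : Finset ℕ :=
  if h : j < x.m then x.indices (x.edge ⟨j, h⟩) else ∅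

variable {x}

@[simp]
theorem vert_mem_toSet {S : Finset ℕ} (i : Fin x.n) : (x.vert i : x.α) ∈ x.toSet S ↔ (i : ℕ) ∈ S := by
  constructor
  · rintro ⟨j, hj, h⟩
    rwa [x.vert.injective (Subtype.ext h)]
  · exact fun h => ⟨i, h, rfl⟩

@[simp]
theorem mem_indices {s : Set x.α} (i : Fin x.n) : (i : ℕ) ∈ x.indices s ↔ (x.vert i : x.α) ∈ s := by
  simp [indices, Fin.val_inj]

theorem indices_subset (s : Set x.α) : x.indices s ⊆ range x.n := by
  intro i
  simp only [indices, mem_map, mem_range]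
  rintro ⟨i, -, rfl⟩
  exact i.2

theorem edgeIndices_subset (j : ℕ) : x.edgeIndices j ⊆ range x.n := by
  rw [edgeIndices]
  split_ifs
  exacts [indices_subset _, by simp]

theorem toSet_indices {s : Set x.α} (hs : s ⊆ x.H.vertexSet) : x.toSet (x.indices s) = s := by
  ext v
  constructor
  · rintro ⟨i, hi, rfl⟩
    simpa using hi
  · intro hv
    obtain ⟨i, hi⟩ := x.vert.surjective ⟨v, hs hv⟩
    have : v = x.vert i := by rw [hi]
    subst this
    simpa using hv

theorem encard_toSet {S : Finset ℕ} (hS : S ⊆ range x.n) : (x.toSet S).encard = S.card := by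
  have hfin : (univ.filter fun i : Fin x.n => (i : ℕ) ∈ S).map Fin.valEmbedding = S := by
    ext i
    simp only [mem_map, mem_filter, mem_univ, true_and, Fin.valEmbedding_apply]
    exact ⟨by rintro ⟨i, h, rfl⟩; exact h, fun h => ⟨⟨i, mem_range.1 (hS h)⟩, h, rfl⟩⟩
  have himg : x.toSet S = (fun i => (x.vert i : x.α)) '' {i : Fin x.n | (i : ℕ) ∈ S} := by
    ext v
    simp [toSet, eq_comm]
  rw [himg, Function.Injective.encard_image fun i j h => x.vert.injective (Subtype.ext h)]
  conv_rhs => rw [← hfin, card_map]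
  rw [← Set.encard_coe_eq_coe_finsetCard]
  simp

/-- All sets involved lie in `V(H)`, so each non-emptiness can be tested on numbers; failure of both
inclusions is `Bad`. -/
theorem isNestSet_delete_toSet_iff {D S : Finset ℕ} (hS : S ⊆ range x.n) :
    (x.H.delete (x.toSet D)).IsNestSet (x.toSet S) ↔ IsNest x.edgeIndices x.n x.m D S := by
  have hidx : ∀ j : Fin x.m, x.edgeIndices j = x.indices (x.edge j) := fun j => by
    simp [edgeIndices]
  have hex : ∀ {s : Set x.α} (_ : s ⊆ x.H.vertexSet), s.Nonempty ↔ ∃ i, (x.vert i : x.α) ∈ s := by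
    intro s hs
    constructor
    · rintro ⟨v, hv⟩
      obtain ⟨i, hi⟩ := x.vert.surjective ⟨v, hs hv⟩
      exact ⟨i, by rwa [hi]⟩
    · rintro ⟨i, hi⟩
      exact ⟨_, hi⟩
  have hexf : ∀ {T : Finset ℕ} (_ : T ⊆ range x.n), T.Nonempty ↔ ∃ i : Fin x.n, (i : ℕ) ∈ T := by
    intro T hT
    constructor
    · rintro ⟨v, hv⟩
      exact ⟨⟨v, mem_range.1 (hT hv)⟩, hv⟩
    · rintro ⟨i, hi⟩
      exact ⟨_, hi⟩
  have hSV : x.toSet S ⊆ x.H.vertexSet := by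
    rintro _ ⟨i, -, rfl⟩
    exact (x.vert i).2
  have hedge : ∀ j, (x.edge j : Set x.α) ⊆ x.H.vertexSet := fun j =>
    x.H.subset_vertexSet_of_mem_edgeSet' (x.edge j).2
  have hsub : ∀ e f, ((x.edge e : Set x.α) \ (x.toSet D ∪ x.toSet S) ⊆ x.edge f) ↔
      ¬ (x.edgeIndices e \ (x.edgeIndices f ∪ S ∪ D)).Nonempty := by
    intro e f
    rw [hexf (sdiff_subset.trans (edgeIndices_subset _)), ← Set.sdiff_eq_empty,
      ← Set.not_nonempty_iff_eq_empty, hex ((Set.sdiff_subset.trans Set.sdiff_subset).trans (hedge e))]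
    refine not_congr (exists_congr fun i => ?_)
    simp only [hidx, Set.mem_sdiff, Set.mem_union, mem_sdiff, Finset.mem_union, mem_indices,
      vert_mem_toSet]
    tauto
  have hint : ∀ e, ((x.edge e : Set x.α) ∩ x.toSet S).Nonempty ↔ (x.edgeIndices e ∩ S).Nonempty := by
    intro e
    rw [hexf (inter_subset_left.trans (edgeIndices_subset _)),
      hex (Set.inter_subset_left.trans (hedge e))]
    refine exists_congr fun i => ?_
    simp [hidx]
  rw [Hypergraph.isNestSet_delete_iff, hex hSV, IsNest, hexf hS]
  refine and_congr (exists_congr fun i => vert_mem_toSet i) (and_congr ?_ ?_)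
  · constructor
    · intro h i hi
      have hi' := mem_range.1 (hS hi)
      have := (h ((vert_mem_toSet ⟨i, hi'⟩).2 hi)).2
      rw [vert_mem_toSet] at this
      exact mem_sdiff.2 ⟨hS hi, this⟩
    · rintro h _ ⟨i, hi, rfl⟩
      refine ⟨(x.vert i).2, fun hD => ?_⟩
      rw [vert_mem_toSet] at hD
      exact (mem_sdiff.1 (h hi)).2 hD
  · constructor
    · rintro h e he f hf ⟨h1, h2, h3, h4⟩
      have := h _ (x.edge ⟨e, he⟩).2 _ (x.edge ⟨f, hf⟩).2 ((hint _).2 h1) ((hint _).2 h2)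
      rw [hsub, hsub] at this
      exact this.elim (fun h => h h3) fun h => h h4
    · intro h e he f hf hes hfs
      obtain ⟨e, rfl⟩ : ∃ i, (x.edge i : Set x.α) = e := ⟨x.edge.symm ⟨e, he⟩, by simp⟩
      obtain ⟨f, rfl⟩ : ∃ i, (x.edge i : Set x.α) = f := ⟨x.edge.symm ⟨f, hf⟩, by simp⟩
      rw [hint] at hes hfs
      rw [hsub, hsub]
      by_contra! hcon
      exact h e e.2 f f.2 ⟨hes, hfs, hcon.1, hcon.2⟩

end NSWInstance

/-! The elimination program and its semantics. -/

namespace ForLang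

open RAM

namespace Expr

/-- The expression is true, that is, it does not evaluate to zero. -/
def Holds (e : Expr) (σ : State) : Prop := e.eval σ ≠ 0

/-- With truncated subtraction this is the minimum of the two values. Addition serves as
disjunction. -/
def and (a b : Expr) : Expr := sub a (sub a b)

def not (a : Expr) : Expr := sub (const 1) a

@[simp]
theorem holds_and {a b : Expr} {σ : State} : (and a b).Holds σ ↔ a.Holds σ ∧ b.Holds σ := by
  simp only [Holds, and, eval]; omega

@[simp]
theorem holds_not {a : Expr} {σ : State} : (not a).Holds σ ↔ ¬ a.Holds σ := by
  simp only [Holds, not, eval]; omega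

@[simp]
theorem holds_add {a b : Expr} {σ : State} : (add a b).Holds σ ↔ a.Holds σ ∨ b.Holds σ := by
  simp only [Holds, eval]; omega

end Expr

namespace Cmd

open ForLang.Expr

theorem sem_ite_of_holds {e : Expr} {p q : Cmd} {σ : State} (h : e.Holds σ) :
    (ite e p q).sem σ = p.sem σ := if_pos h

theorem sem_ite_of_not_holds {e : Expr} {p q : Cmd} {σ : State} (h : ¬ e.Holds σ) :
    (ite e p q).sem σ = q.sem σ := if_neg h

/-- Decide whether `c` holds for some value of `i` less than `Rb`. -/
def any (x i b : ℕ) (c : Expr) : Cmd :=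
  seq (assign x (const 0)) (.forLt i b (ite c (assign x (const 1)) skip))

/-- Put ones into the array `a` at all positions `i` less than `Rb` for which `c` holds. -/
def mark (a i b : ℕ) (c : Expr) : Cmd := .forLt i b (ite c (store a (var i) (const 1)) skip)

theorem any_spec {x i b : ℕ} {c : Expr} {σ : State} {Q : ℕ → Prop} (hxi : x ≠ i) (hxb : x ≠ b)
    (hc : ∀ ρ : State, (∀ r, r ≠ x → r ≠ i → ρ.reg r = σ.reg r) → ρ.arr = σ.arr →
      ρ.reg i < σ.reg b → (c.Holds ρ ↔ Q (ρ.reg i))) :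
    ((any x i b c).sem σ).reg x ≠ 0 ↔ ∃ j < σ.reg b, Q j := by
  have hb : (σ.setReg x 0).reg b = σ.reg b := by simp [hxb.symm]
  have := forLt_induction (i := i) (b := b) (p := ite c (assign x (const 1)) skip)
    (σ := σ.setReg x 0) (fun k ρ => ρ.reg x ≠ 0 ↔ ∃ j < k, Q j) (by simp [hxi]) ?_
  · rwa [hb] at this
  · intro j hj ρ hI hi hr ha
    rw [hb] at hj
    have hcρ : c.Holds ρ ↔ Q j := by
      rw [hc ρ (fun r hrx hri => ?_) (funext fun a => ha a rfl) (by rwa [hi]), hi]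
      rw [hr r (by simp [writes, hrx.symm, hri.symm])]
      simp [hrx]
    rw [State.reg_setReg, if_neg hxi]
    by_cases hQ : Q j
    · rw [sem_ite_of_holds (hcρ.2 hQ)]
      simp only [sem, State.reg_setReg, if_true, eval]
      exact ⟨fun _ => ⟨j, by omega, hQ⟩, fun _ => one_ne_zero⟩
    · rw [sem_ite_of_not_holds (hcρ.not.2 hQ)]
      simp only [sem]
      rw [hI]
      refine ⟨fun ⟨l, hl, h⟩ => ⟨l, by omega, h⟩, fun ⟨l, hl, h⟩ => ⟨l, ?_, h⟩⟩
      have : l ≠ j := by rintro rfl; exact hQ h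
      omega

/-- The truth of the condition must not depend on the array `a`, so that marks made earlier in the
loop cannot influence later tests. -/
theorem mark_spec {a i b : ℕ} {c : Expr} {σ : State} {Q : ℕ → Prop}
    (hc : ∀ ρ : State, (∀ r, r ≠ i → ρ.reg r = σ.reg r) → (∀ a', a' ≠ a → ρ.arr a' = σ.arr a') →
      ρ.reg i < σ.reg b → (c.Holds ρ ↔ Q (ρ.reg i))) (v : ℕ) :
    ((mark a i b c).sem σ).arr a v ≠ 0 ↔ σ.arr a v ≠ 0 ∨ v < σ.reg b ∧ Q v := by
  refine forLt_induction (i := i) (b := b) (p := ite c (store a (var i) (const 1)) skip)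
    (fun k ρ => ρ.arr a v ≠ 0 ↔ σ.arr a v ≠ 0 ∨ v < k ∧ Q v) (by simp) ?_
  intro j hj ρ hI hi hr ha
  have hcρ : c.Holds ρ ↔ Q j := by
    rw [hc ρ (fun r hri => hr r (by simp [writes, hri.symm]))
      (fun a' h => ha a' (by simp [writesArr, h.symm])) (by rwa [hi]), hi]
  rw [State.arr_setReg]
  by_cases hQ : Q j
  · rw [sem_ite_of_holds (hcρ.2 hQ)]
    simp only [sem, State.arr_setArr, eval, hi, true_and]
    by_cases hv : v = j
    · subst hv
      simp [hQ]
    · rw [if_neg hv, hI]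
      have : v < j + 1 ↔ v < j := by omega
      rw [this]
  · rw [sem_ite_of_not_holds (hcρ.not.2 hQ)]
    simp only [sem]
    rw [hI]
    refine or_congr_right (and_congr_left fun h => ?_)
    have : v ≠ j := by rintro rfl; exact hQ h
    omega

end Cmd

end ForLang

namespace NestSearch

open Finset RAM ForLang Expr Cmd

/-! Registers: `1` length of the output, `2` number of vertices, `3` number of edges, `4` the
parameter `k`, `5` the power `2 ^ k`, `6` sweep, `7` first vertex of the candidate set, `8` word of
binary choices, `9` remaining choices, `10` flag, `11` pass, `12` and `13` edges, `14` vertex,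
`15` to `18` results of tests, `19` size of the candidate set, `20` offset. Arrays: `0` input,
`1` output, `2` deleted vertices, `3` candidate set, `4` positions of the edges in the input. -/

/-- The vertex `R14` is in the edge `Ry`. -/
def edgeExpr (y : ℕ) : Expr := load 0 (add (load 4 (var y)) (var 14))

def meetCmd (x y : ℕ) : Cmd := any x 14 2 (and (edgeExpr y) (load 3 (var 14)))

def differCmd (x y z : ℕ) : Cmd := any x 14 2
  (and (edgeExpr y) (not (add (add (edgeExpr z) (load 3 (var 14))) (load 2 (var 14)))))

def extendCmd (y z : ℕ) : Cmd := mark 3 14 2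
  (and (edgeExpr y) (not (add (edgeExpr z) (load 2 (var 14)))))

/-- A number minus twice its rounded half is its parity, the next binary choice. -/
def resolveCmd : Cmd :=
  seq (ite (sub (var 9) (add (half (var 9)) (half (var 9)))) (extendCmd 12 13) (extendCmd 13 12))
    (seq (assign 9 (half (var 9))) (assign 10 (const 1)))

def stepCmd : Cmd :=
  seq (seq (seq (meetCmd 15 12) (meetCmd 16 13)) (seq (differCmd 17 12 13) (differCmd 18 13 12)))
    (ite (and (var 15) (and (var 16) (and (var 17) (var 18)))) resolveCmd skip)

def passCmd : Cmd := .forLt 12 3 (.forLt 13 3 stepCmd)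

def searchCmd : Cmd :=
  seq (seq (seq (.forLt 14 2 (store 3 (var 14) (const 0))) (store 3 (var 7) (const 1)))
    (seq (assign 9 (var 8)) (assign 10 (const 1))))
    (.forLt 11 4 (seq (assign 10 (const 0)) passCmd))

def countCmd : Cmd :=
  seq (assign 19 (const 0)) (.forLt 14 2 (ite (load 3 (var 14)) (assign 19 (add (var 19) (const 1))) skip))

def outputCmd (e : Expr) : Cmd := seq (store 1 (var 1) e) (assign 1 (add (var 1) (const 1)))

def emitCmd : Cmd :=
  seq (.forLt 14 2 (ite (load 3 (var 14))
    (seq (outputCmd (add (var 14) (const 1))) (store 2 (var 14) (const 1))) skip))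
    (outputCmd (const 0))

def attemptCmd : Cmd :=
  ite (load 2 (var 7)) skip (seq searchCmd (seq countCmd
    (ite (and (not (var 10)) (not (sub (var 19) (var 4)))) emitCmd skip)))

/-- A sweep started when some search can succeed deletes at least one vertex, so `n` sweeps replace
an unbounded loop. -/
def eliminateCmd : Cmd := .forLt 6 2 (.forLt 7 2 (.forLt 8 5 attemptCmd))

/-- Rejects if a vertex survives, and also if there are edges but no vertices, which means `H = (∅,
{∅})`. Cell `0` of the output is reserved for the verdict. -/
def answerCmd : Cmd :=
  seq (any 15 14 2 (not (load 2 (var 14))))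
    (ite (add (var 15) (and (var 3) (not (var 2))))
      (seq (store 1 (const 0) (const 0)) (assign 1 (const 1)))
      (store 1 (const 0) (const 1)))

/-- The state describes the hypergraph with vertices `0, …, n - 1` and edges `E 0, …, E (m - 1)`. -/
structure Ctx (E : ℕ → Finset ℕ) (n m k : ℕ) (σ : State) : Prop where
  reg_n : σ.reg 2 = n
  reg_m : σ.reg 3 = m
  reg_k : σ.reg 4 = k
  reg_pow : σ.reg 5 = 2 ^ k
  edge : ∀ e < m, ∀ v < n, σ.arr 0 (σ.arr 4 e + v) ≠ 0 ↔ v ∈ E e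
  subset : ∀ e < m, E e ⊆ range n

/-! ### Semantics of the individual commands. -/

variable {E : ℕ → Finset ℕ} {n m k : ℕ} {σ : State}

theorem Ctx.congr {τ : State} (h : Ctx E n m k σ) (h2 : τ.reg 2 = σ.reg 2)
    (h3 : τ.reg 3 = σ.reg 3) (h4 : τ.reg 4 = σ.reg 4) (h5 : τ.reg 5 = σ.reg 5)
    (h0 : τ.arr 0 = σ.arr 0) (h4' : τ.arr 4 = σ.arr 4) : Ctx E n m k τ :=
  ⟨h2.trans h.reg_n, h3.trans h.reg_m, h4.trans h.reg_k, h5.trans h.reg_pow,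
    by rw [h0, h4']; exact h.edge, h.subset⟩

/-- The hypothesis is a syntactic Boolean check, so `rfl` proves it for concrete commands. -/
theorem Ctx.sem {p : Cmd} (h : Ctx E n m k σ)
    (hp : (p.writes 2 || p.writes 3 || p.writes 4 || p.writes 5 || p.writesArr 0 ||
      p.writesArr 4) = false) : Ctx E n m k (p.sem σ) := by
  simp only [Bool.or_eq_false_iff] at hp
  obtain ⟨⟨⟨⟨⟨h2, h3⟩, h4⟩, h5⟩, h0⟩, h4'⟩ := hp
  exact h.congr (p.sem_reg _ h2) (p.sem_reg _ h3) (p.sem_reg _ h4) (p.sem_reg _ h5)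
    (p.sem_arr _ h0) (p.sem_arr _ h4')

theorem Ctx.setReg (h : Ctx E n m k σ) {x c : ℕ} (hx : 5 < x) : Ctx E n m k (σ.setReg x c) :=
  h.congr (by rw [State.reg_setReg, if_neg (by omega)]) (by rw [State.reg_setReg, if_neg (by omega)])
    (by rw [State.reg_setReg, if_neg (by omega)]) (by rw [State.reg_setReg, if_neg (by omega)])
    rfl rfl

theorem Ctx.holds_edgeExpr (h : Ctx E n m k σ) {ρ : State} {y : ℕ} (hy : ρ.reg y = σ.reg y)
    (hym : σ.reg y < m) (h0 : ρ.arr 0 = σ.arr 0) (h4 : ρ.arr 4 = σ.arr 4) (hv : ρ.reg 14 < n) :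
    (edgeExpr y).Holds ρ ↔ ρ.reg 14 ∈ E (σ.reg y) := by
  rw [← h.edge _ hym _ hv]
  simp [edgeExpr, Holds, eval, hy, h0, h4]

/-- The positions below `n` of the nonzero values. -/
def supp (n : ℕ) (A : ℕ → ℕ) : Finset ℕ := (range n).filter fun v => A v ≠ 0

theorem mem_supp {A : ℕ → ℕ} {v : ℕ} : v ∈ supp n A ↔ v < n ∧ A v ≠ 0 := by simp [supp]

theorem meetCmd_spec (h : Ctx E n m k σ) {x y : ℕ} (hx : 14 < x) (hy : y ≠ 14) (hxy : x ≠ y)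
    (hym : σ.reg y < m) :
    ((meetCmd x y).sem σ).reg x ≠ 0 ↔ (E (σ.reg y) ∩ supp n (σ.arr 3)).Nonempty := by
  rw [meetCmd, any_spec (Q := fun v => v ∈ E (σ.reg y) ∩ supp n (σ.arr 3)) (by omega) (by omega)]
  · rw [h.reg_n]
    exact exists_congr fun v => and_iff_right_of_imp fun hv =>
      (mem_supp.1 (mem_inter.1 hv).2).1
  · intro ρ hr ha hv
    rw [h.reg_n] at hv
    rw [holds_and, h.holds_edgeExpr (hr y hxy.symm hy) hym (by rw [ha]) (by rw [ha]) hv, mem_inter,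
      mem_supp]
    simp [Holds, eval, ha, hv]

theorem differCmd_spec (h : Ctx E n m k σ) {x y z : ℕ} (hx : 14 < x) (hy : y ≠ 14) (hxy : x ≠ y)
    (hz : z ≠ 14) (hxz : x ≠ z) (hym : σ.reg y < m) (hzm : σ.reg z < m) :
    ((differCmd x y z).sem σ).reg x ≠ 0 ↔
      (E (σ.reg y) \ (E (σ.reg z) ∪ supp n (σ.arr 3) ∪ supp n (σ.arr 2))).Nonempty := by
  rw [differCmd, any_spec (Q := fun v => v ∈ E (σ.reg y) \
    (E (σ.reg z) ∪ supp n (σ.arr 3) ∪ supp n (σ.arr 2))) (by omega) (by omega)]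
  · rw [h.reg_n]
    exact exists_congr fun v => and_iff_right_of_imp fun hv =>
      mem_range.1 (h.subset _ hym (mem_sdiff.1 hv).1)
  · intro ρ hr ha hv
    rw [h.reg_n] at hv
    simp only [holds_and, holds_not, holds_add,
      h.holds_edgeExpr (hr y hxy.symm hy) hym (by rw [ha]) (by rw [ha]) hv,
      h.holds_edgeExpr (hr z hxz.symm hz) hzm (by rw [ha]) (by rw [ha]) hv, mem_sdiff, mem_union,
      mem_supp]
    simp [Holds, eval, ha, hv]

theorem extendCmd_spec (h : Ctx E n m k σ) {y z : ℕ} (hy : y ≠ 14) (hz : z ≠ 14)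
    (hym : σ.reg y < m) (hzm : σ.reg z < m) :
    supp n (((extendCmd y z).sem σ).arr 3) =
      supp n (σ.arr 3) ∪ E (σ.reg y) \ (E (σ.reg z) ∪ supp n (σ.arr 2)) := by
  ext v
  rw [mem_supp, extendCmd,
    mark_spec (Q := fun v => v ∈ E (σ.reg y) \ (E (σ.reg z) ∪ supp n (σ.arr 2)))]
  · rw [h.reg_n, mem_union, mem_supp]
    have : v ∈ E (σ.reg y) \ (E (σ.reg z) ∪ supp n (σ.arr 2)) → v < n := fun hv =>
      mem_range.1 (h.subset _ hym (mem_sdiff.1 hv).1)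
    tauto
  · intro ρ hr ha hv
    rw [h.reg_n] at hv
    simp only [holds_and, holds_not, holds_add,
      h.holds_edgeExpr (hr y hy) hym (ha 0 (by decide)) (ha 4 (by decide)) hv,
      h.holds_edgeExpr (hr z hz) hzm (ha 0 (by decide)) (ha 4 (by decide)) hv, mem_sdiff, mem_union,
      mem_supp]
    simp [Holds, eval, ha 2 (by decide), hv]

/-- The configuration of the search that the state represents. -/
def config (n : ℕ) (σ : State) : Config := (supp n (σ.arr 3), σ.reg 9, σ.reg 10)

theorem resolveCmd_spec (h : Ctx E n m k σ) (he : σ.reg 12 < m) (hf : σ.reg 13 < m) :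
    config n (resolveCmd.sem σ) = (supp n (σ.arr 3) ∪
      (if σ.reg 9 % 2 ≠ 0 then E (σ.reg 12) \ (E (σ.reg 13) ∪ supp n (σ.arr 2))
        else E (σ.reg 13) \ (E (σ.reg 12) ∪ supp n (σ.arr 2))), σ.reg 9 / 2, 1) := by
  have hodd : (sub (var 9) (add (half (var 9)) (half (var 9)))).Holds σ ↔ σ.reg 9 % 2 ≠ 0 := by
    simp only [Holds, eval]; omega
  by_cases h9 : σ.reg 9 % 2 ≠ 0
  · have h9' := (extendCmd 12 13).sem_reg σ (r := 9) rfl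
    rw [resolveCmd, sem, sem_ite_of_holds (hodd.2 h9), if_pos h9,
      ← extendCmd_spec h (by decide) (by decide) he hf]
    simp [config, sem, eval, h9']
  · have h9' := (extendCmd 13 12).sem_reg σ (r := 9) rfl
    rw [resolveCmd, sem, sem_ite_of_not_holds (hodd.not.2 h9), if_neg h9,
      ← extendCmd_spec h (by decide) (by decide) hf he]
    simp [config, sem, eval, h9']

theorem stepCmd_spec (h : Ctx E n m k σ) (he : σ.reg 12 < m) (hf : σ.reg 13 < m) :
    config n (stepCmd.sem σ) =
      step E (supp n (σ.arr 2)) (σ.reg 12) (σ.reg 13) (config n σ) := by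
  -- The four tests write only their result registers and the counter `14`, so all of them see the
  -- arrays and the edge registers of `σ`.
  let σ₁ := (meetCmd 15 12).sem σ
  let σ₂ := (meetCmd 16 13).sem σ₁
  let σ₃ := (differCmd 17 12 13).sem σ₂
  let σ₄ := (differCmd 18 13 12).sem σ₃
  have c₁ : Ctx E n m k σ₁ := h.sem rfl
  have c₂ : Ctx E n m k σ₂ := c₁.sem rfl
  have c₃ : Ctx E n m k σ₃ := c₂.sem rfl
  have c₄ : Ctx E n m k σ₄ := c₃.sem rfl
  have e₁ : ∀ r < 14, σ₁.reg r = σ.reg r := fun r hr =>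
    sem_reg _ _ (by simp [meetCmd, any, writes]; omega)
  have e₂ : ∀ r < 14, σ₂.reg r = σ.reg r := fun r hr =>
    (sem_reg _ _ (by simp [meetCmd, any, writes]; omega)).trans (e₁ r hr)
  have e₃ : ∀ r < 14, σ₃.reg r = σ.reg r := fun r hr =>
    (sem_reg _ _ (by simp [differCmd, any, writes]; omega)).trans (e₂ r hr)
  have e₄ : ∀ r < 14, σ₄.reg r = σ.reg r := fun r hr =>
    (sem_reg _ _ (by simp [differCmd, any, writes]; omega)).trans (e₃ r hr)
  have a₁ : σ₁.arr = σ.arr := funext fun a => sem_arr _ _ rfl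
  have a₂ : σ₂.arr = σ.arr := (funext fun a => sem_arr _ _ rfl).trans a₁
  have a₃ : σ₃.arr = σ.arr := (funext fun a => sem_arr _ _ rfl).trans a₂
  have a₄ : σ₄.arr = σ.arr := (funext fun a => sem_arr _ _ rfl).trans a₃
  have t₁ := meetCmd_spec h (x := 15) (y := 12) (by decide) (by decide) (by decide) he
  have t₂ := meetCmd_spec c₁ (x := 16) (y := 13) (by decide) (by decide) (by decide)
    (by rwa [e₁ _ (by decide)])
  have t₃ := differCmd_spec c₂ (x := 17) (y := 12) (z := 13) (by decide) (by decide) (by decide)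
    (by decide) (by decide) (by rwa [e₂ _ (by decide)]) (by rwa [e₂ _ (by decide)])
  have t₄ := differCmd_spec c₃ (x := 18) (y := 13) (z := 12) (by decide) (by decide) (by decide)
    (by decide) (by decide) (by rwa [e₃ _ (by decide)]) (by rwa [e₃ _ (by decide)])
  rw [e₁ _ (by decide), a₁] at t₂
  rw [e₂ _ (by decide), e₂ _ (by decide), a₂] at t₃
  rw [e₃ _ (by decide), e₃ _ (by decide), a₃] at t₄
  have u₁ : σ₄.reg 15 = σ₁.reg 15 :=
    (sem_reg _ _ rfl).trans ((sem_reg _ _ rfl).trans (sem_reg _ _ rfl))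
  have u₂ : σ₄.reg 16 = σ₂.reg 16 := (sem_reg _ _ rfl).trans (sem_reg _ _ rfl)
  have u₃ : σ₄.reg 17 = σ₃.reg 17 := sem_reg _ _ rfl
  have hbad : (and (var 15) (and (var 16) (and (var 17) (var 18)))).Holds σ₄ ↔
      Bad E (supp n (σ.arr 2)) (config n σ).1 (σ.reg 12) (σ.reg 13) := by
    simp only [holds_and]
    refine and_congr ?_ (and_congr ?_ (and_congr ?_ t₄))
    · change σ₄.reg 15 ≠ 0 ↔ _; rw [u₁]; exact t₁
    · change σ₄.reg 16 ≠ 0 ↔ _; rw [u₂]; exact t₂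
    · change σ₄.reg 17 ≠ 0 ↔ _; rw [u₃]; exact t₃
  have hsem : stepCmd.sem σ =
      (ite (and (var 15) (and (var 16) (and (var 17) (var 18)))) resolveCmd skip).sem σ₄ := rfl
  rw [hsem, step]
  by_cases hb : Bad E (supp n (σ.arr 2)) (config n σ).1 (σ.reg 12) (σ.reg 13)
  · rw [sem_ite_of_holds (hbad.2 hb), if_pos hb, resolveCmd_spec c₄ (by rwa [e₄ _ (by decide)])
      (by rwa [e₄ _ (by decide)]), a₄, e₄ 9 (by decide), e₄ 12 (by decide), e₄ 13 (by decide)]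
    rfl
  · rw [sem_ite_of_not_holds (hbad.not.2 hb), if_neg hb]
    change config n σ₄ = _
    simp only [config, a₄, e₄ 9 (by decide), e₄ 10 (by decide)]

theorem config_setReg {x c : ℕ} (h9 : x ≠ 9) (h10 : x ≠ 10) :
    config n (σ.setReg x c) = config n σ := by
  simp [config, h9.symm, h10.symm]

theorem passCmd_spec (h : Ctx E n m k σ) :
    config n (passCmd.sem σ) = pass E (supp n (σ.arr 2)) m (config n σ) := by
  have hm := h.reg_m
  have inner : ∀ ρ, Ctx E n m k ρ → ρ.reg 12 < m → config n ((Cmd.forLt 13 3 stepCmd).sem ρ) =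
      iter (fun f => step E (supp n (ρ.arr 2)) (ρ.reg 12) f) m (config n ρ) := by
    intro ρ hρ he
    conv_rhs => rw [← hρ.reg_m]
    refine forLt_induction (fun j τ => Ctx E n m k τ ∧ config n τ =
      iter (fun f => step E (supp n (ρ.arr 2)) (ρ.reg 12) f) j (config n ρ))
      ⟨hρ.setReg (by decide), config_setReg (by decide) (by decide)⟩ ?_ |>.2
    rintro j hj τ ⟨hτ, hc⟩ hi hr ha
    refine ⟨(hτ.sem rfl).setReg (by decide), ?_⟩
    have h12 := hr 12 rfl
    rw [config_setReg (by decide) (by decide), stepCmd_spec hτ (by rwa [h12])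
      (by rwa [hi, ← hρ.reg_m]), h12, hi, ha 2 rfl, hc, iter]
  rw [pass]
  conv_rhs => rw [← hm]
  refine forLt_induction (fun j τ => Ctx E n m k τ ∧ config n τ =
    iter (fun e => iter (fun f => step E (supp n (σ.arr 2)) e f) (σ.reg 3)) j (config n σ))
    ⟨h.setReg (by decide), config_setReg (by decide) (by decide)⟩ ?_ |>.2
  rintro j hj τ ⟨hτ, hc⟩ hi hr ha
  refine ⟨(hτ.sem rfl).setReg (by decide), ?_⟩
  rw [config_setReg (by decide) (by decide), inner τ hτ (by rwa [hi, ← hm]), hc, hi, ha 2 rfl,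
    ← hm, iter]

theorem searchCmd_spec (h : Ctx E n m k σ) (hv : σ.reg 7 < n) :
    config n (searchCmd.sem σ) = search E (supp n (σ.arr 2)) m k (σ.reg 7) (σ.reg 8) := by
  let σ₁ := (Cmd.forLt 14 2 (store 3 (var 14) (const 0))).sem σ
  let σ₂ := (seq (store 3 (var 7) (const 1)) (seq (assign 9 (var 8)) (assign 10 (const 1)))).sem σ₁
  have c₁ : Ctx E n m k σ₁ := h.sem rfl
  have c₂ : Ctx E n m k σ₂ := c₁.sem rfl
  -- The array may still hold the candidate set of an earlier search.
  have hclear : ∀ v < σ.reg 2, σ₁.arr 3 v = 0 := by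
    refine forLt_induction (fun j τ => ∀ v < j, τ.arr 3 v = 0) (by simp) ?_
    intro j hj τ hI hi hr ha v hvj
    simp only [sem, State.arr_setReg, State.arr_setArr, eval, hi, true_and]
    split_ifs
    · rfl
    · exact hI v (by omega)
  have h7 : σ₁.reg 7 = σ.reg 7 := sem_reg _ _ rfl
  have h8 : σ₁.reg 8 = σ.reg 8 := sem_reg _ _ rfl
  have hconf : config n σ₂ = ({σ.reg 7}, σ.reg 8, 1) := by
    have : supp n (σ₂.arr 3) = {σ.reg 7} := by
      ext v
      rw [mem_supp, mem_singleton]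
      simp only [σ₂, sem, State.arr_setReg, State.arr_setArr, eval, true_and, h7]
      constructor
      · rintro ⟨h1, h2⟩
        by_contra hne
        rw [if_neg hne, hclear v (by rwa [h.reg_n])] at h2
        exact h2 rfl
      · rintro rfl
        simpa using hv
    simp only [config, this]
    simp [σ₂, sem, eval, h8]
  have ha2 : σ₂.arr 2 = σ.arr 2 := (sem_arr _ _ rfl).trans (sem_arr _ _ rfl)
  have hsem : searchCmd.sem σ = (Cmd.forLt 11 4 (seq (assign 10 (const 0)) passCmd)).sem σ₂ := rfl
  rw [hsem, search, ← hconf, ← ha2]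
  conv_rhs => rw [← c₂.reg_k]
  refine forLt_induction (fun j τ => Ctx E n m k τ ∧ config n τ =
    iter (fun _ c => pass E (supp n (σ₂.arr 2)) m (c.1, c.2.1, 0)) j (config n σ₂))
    ⟨c₂.setReg (by decide), config_setReg (by decide) (by decide)⟩ ?_ |>.2
  rintro j hj τ ⟨hτ, hc⟩ hi hr ha
  refine ⟨(hτ.sem rfl).setReg (by decide), ?_⟩
  have hτ' : Ctx E n m k (τ.setReg 10 0) := hτ.setReg (by decide)
  rw [config_setReg (by decide) (by decide), iter, ← hc, ← ha 2 rfl]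
  exact passCmd_spec hτ'

theorem countCmd_spec (h : Ctx E n m k σ) :
    (countCmd.sem σ).reg 19 = (supp n (σ.arr 3)).card := by
  have := forLt_induction (i := 14) (b := 2) (σ := σ.setReg 19 0)
    (p := ite (load 3 (var 14)) (assign 19 (add (var 19) (const 1))) skip)
    (fun j τ => τ.reg 19 = (supp j (σ.arr 3)).card) (by simp [supp]) ?_
  · rw [← h.reg_n]
    exact this
  · intro j hj τ hI hi hr ha
    have ha3 : τ.arr 3 = σ.arr 3 := ha 3 rfl
    have hh : (load 3 (var 14)).Holds τ ↔ σ.arr 3 j ≠ 0 := by simp [Holds, eval, hi, ha3]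
    rw [supp, range_add_one, filter_insert]
    by_cases h3 : σ.arr 3 j ≠ 0
    · rw [sem_ite_of_holds (hh.2 h3), if_pos h3, card_insert_of_notMem (by simp)]
      simp [sem, eval, hI, supp]
    · rw [sem_ite_of_not_holds (hh.not.2 h3), if_neg h3]
      simpa [sem, supp] using hI

theorem output_outputCmd (e : Expr) (σ : State) :
    ((outputCmd e).sem σ).output = σ.output ++ [e.eval σ] := by
  simp only [State.output, outputCmd, sem, State.reg_setReg, if_true, eval, State.reg_setArr,
    State.arr_setReg, List.range_succ, List.map_append]
  congr 1
  · refine List.map_congr_left fun i hi => ?_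
    rw [List.mem_range] at hi
    simp [hi.ne]
  · simp

theorem output_congr {τ : State} (h : τ.reg 1 = σ.reg 1) (h' : τ.arr 1 = σ.arr 1) :
    τ.output = σ.output := by
  rw [State.output, State.output, h, h']

theorem output_setReg {x c : ℕ} (hx : x ≠ 1) : (σ.setReg x c).output = σ.output :=
  output_congr (by simp [hx.symm]) rfl

theorem emitCmd_spec (h : Ctx E n m k σ) : ∃ l : List ℕ, l.toFinset = supp n (σ.arr 3) ∧
    (emitCmd.sem σ).output = σ.output ++ (l.map (· + 1) ++ [0]) ∧
    supp n ((emitCmd.sem σ).arr 2) = supp n (σ.arr 2) ∪ supp n (σ.arr 3) := by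
  have key := forLt_induction (i := 14) (b := 2) (σ := σ)
    (p := ite (load 3 (var 14))
      (seq (outputCmd (add (var 14) (const 1))) (store 2 (var 14) (const 1))) skip)
    (fun j τ => (∃ l : List ℕ, l.toFinset = supp j (σ.arr 3) ∧
      τ.output = σ.output ++ l.map (· + 1)) ∧
      ∀ v, τ.arr 2 v ≠ 0 ↔ σ.arr 2 v ≠ 0 ∨ v ∈ supp j (σ.arr 3)) ?_ ?_
  · obtain ⟨⟨l, hl, hout⟩, hdel⟩ := key
    rw [h.reg_n] at hl hdel
    refine ⟨l, hl, ?_, ?_⟩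
    · rw [emitCmd, sem, output_outputCmd, hout, eval, List.append_assoc]
    · ext v
      rw [emitCmd, sem, mem_supp, sem_arr (a := 2) _ _ rfl, hdel, mem_union, mem_supp, mem_supp]
      tauto
  · refine ⟨⟨[], by simp [supp], ?_⟩, fun v => by simp [supp]⟩
    rw [output_setReg (by decide)]
    simp
  · rintro j hj τ ⟨⟨l, hl, hout⟩, hdel⟩ hi hr ha
    have ha3 : τ.arr 3 = σ.arr 3 := ha 3 rfl
    have hh : (load 3 (var 14)).Holds τ ↔ σ.arr 3 j ≠ 0 := by simp [Holds, eval, hi, ha3]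
    have hsupp : supp (j + 1) (σ.arr 3) =
        if σ.arr 3 j ≠ 0 then insert j (supp j (σ.arr 3)) else supp j (σ.arr 3) := by
      rw [supp, range_add_one, filter_insert]; rfl
    rw [output_setReg (by decide), hsupp]
    by_cases h3 : σ.arr 3 j ≠ 0
    · rw [sem_ite_of_holds (hh.2 h3), if_pos h3]
      refine ⟨⟨l ++ [j], ?_, ?_⟩, fun v => ?_⟩
      · rw [List.toFinset_append, hl, union_comm]; rfl
      · have hstore : ∀ ρ, ((store 2 (var 14) (const 1)).sem ρ).output = ρ.output := fun ρ =>
          output_congr rfl (sem_arr _ _ rfl)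
        rw [sem, hstore, output_outputCmd, hout]
        simp [eval, hi]
      · have h14 : ((outputCmd (add (var 14) (const 1))).sem τ).reg 14 = j :=
          (sem_reg _ _ rfl).trans hi
        have h2 : ((outputCmd (add (var 14) (const 1))).sem τ).arr 2 = τ.arr 2 := sem_arr _ _ rfl
        have hd := hdel v
        simp only [sem, State.arr_setReg, State.arr_setArr, eval, h14, true_and, h2, mem_insert]
        by_cases hv : v = j
        · simp [hv]
        · simp only [hv, if_false, false_or]; exact hd
    · rw [sem_ite_of_not_holds (hh.not.2 h3), if_neg h3]
      exact ⟨⟨l, hl, hout⟩, hdel⟩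

end NestSearch

/-! ### Correctness of the greedy elimination. -/

namespace NestSearch

open Finset RAM ForLang Expr Cmd

variable {E : ℕ → Finset ℕ} {n m k : ℕ} {σ : State}

/-- The search from the vertex `v` with the binary choices `b` finds a nest-set. -/
def Success (E : ℕ → Finset ℕ) (m k : ℕ) (D : Finset ℕ) (v b : ℕ) : Prop :=
  v ∉ D ∧ (search E D m k v b).2.2 = 0 ∧ (search E D m k v b).1.card ≤ k

/-- No search finds a nest-set. -/
def Stuck (E : ℕ → Finset ℕ) (n m k : ℕ) (D : Finset ℕ) : Prop :=
  ∀ v < n, ∀ b < 2 ^ k, ¬ Success E m k D v b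

/-- A nest-set with at most `k` elements would be discovered from any of its vertices, by
completeness of the search. -/
theorem Stuck.not_isNest {D s : Finset ℕ} (h : Stuck E n m k D) (hs : IsNest E n m D s) :
    k < s.card := by
  by_contra! hk
  obtain ⟨v, hv⟩ := hs.1
  obtain ⟨b, hb, h1, h2⟩ := search_complete hs hv hk
  have := mem_sdiff.1 (hs.2.1 hv)
  exact h v (mem_range.1 this.1) b hb ⟨this.2, h1, h2⟩

/-- The lists enumerate nest-sets that are successively eliminated, and `D` is their union. -/
inductive Elimination (E : ℕ → Finset ℕ) (n m k : ℕ) : List (List ℕ) → Finset ℕ → Prop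
  | nil : Elimination E n m k [] ∅
  | snoc {L : List (List ℕ)} {D : Finset ℕ} {l : List ℕ} : Elimination E n m k L D →
      IsNest E n m D l.toFinset → l.toFinset.card ≤ k →
      Elimination E n m k (L ++ [l]) (D ∪ l.toFinset)

/-- The state contains an initial part of an elimination and its description. -/
def Inv (E : ℕ → Finset ℕ) (n m k : ℕ) (σ : State) : Prop :=
  Ctx E n m k σ ∧ ∃ L, Elimination E n m k L (supp n (σ.arr 2)) ∧
    σ.output = 0 :: (L.map fun l => l.map (· + 1) ++ [0]).flatten

theorem Inv.setReg (h : Inv E n m k σ) {x c : ℕ} (hx : 5 < x) : Inv E n m k (σ.setReg x c) :=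
  ⟨h.1.setReg hx, by rw [output_setReg (by omega)]; exact h.2⟩

theorem attemptCmd_spec (h : Inv E n m k σ) (hv : σ.reg 7 < n) :
    Inv E n m k (attemptCmd.sem σ) ∧
    ((¬ Success E m k (supp n (σ.arr 2)) (σ.reg 7) (σ.reg 8) ∧
      supp n ((attemptCmd.sem σ).arr 2) = supp n (σ.arr 2)) ∨
    (Success E m k (supp n (σ.arr 2)) (σ.reg 7) (σ.reg 8) ∧
      supp n (σ.arr 2) ⊂ supp n ((attemptCmd.sem σ).arr 2))) := by
  have c₀ : Ctx E n m k (attemptCmd.sem σ) := h.1.sem rfl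
  have hmem : (load 2 (var 7)).Holds σ ↔ σ.reg 7 ∈ supp n (σ.arr 2) := by
    simp [mem_supp, hv, Holds, eval]
  by_cases hD : σ.reg 7 ∈ supp n (σ.arr 2)
  · rw [attemptCmd, sem_ite_of_holds (hmem.2 hD)]
    exact ⟨h, Or.inl ⟨fun hs => hs.1 hD, rfl⟩⟩
  let σ₁ := searchCmd.sem σ
  let σ₂ := countCmd.sem σ₁
  have c₁ : Ctx E n m k σ₁ := h.1.sem rfl
  have c₂ : Ctx E n m k σ₂ := c₁.sem rfl
  have hsearch : config n σ₁ = _ := searchCmd_spec h.1 hv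
  have hcount : σ₂.reg 19 = _ := countCmd_spec c₁
  have h10 : σ₂.reg 10 = (search E (supp n (σ.arr 2)) m k (σ.reg 7) (σ.reg 8)).2.2 := by
    rw [← hsearch]; exact sem_reg _ _ rfl
  have h3 : supp n (σ₂.arr 3) = (search E (supp n (σ.arr 2)) m k (σ.reg 7) (σ.reg 8)).1 := by
    rw [← hsearch, show σ₂.arr 3 = σ₁.arr 3 from sem_arr _ _ rfl]; rfl
  have h19 : σ₂.reg 19 = (search E (supp n (σ.arr 2)) m k (σ.reg 7) (σ.reg 8)).1.card := by
    rw [hcount, ← hsearch]; rfl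
  have h2 : σ₂.arr 2 = σ.arr 2 := (sem_arr _ _ rfl).trans (sem_arr _ _ rfl)
  have hout : σ₂.output = σ.output :=
    output_congr ((sem_reg _ _ rfl).trans (sem_reg _ _ rfl))
      ((sem_arr _ _ rfl).trans (sem_arr _ _ rfl))
  have hcond : (and (not (var 10)) (not (sub (var 19) (var 4)))).Holds σ₂ ↔
      Success E m k (supp n (σ.arr 2)) (σ.reg 7) (σ.reg 8) := by
    have e1 : (var 10).Holds σ₂ ↔ σ₂.reg 10 ≠ 0 := Iff.rfl
    have e2 : (sub (var 19) (var 4)).Holds σ₂ ↔ σ₂.reg 19 - σ₂.reg 4 ≠ 0 := Iff.rfl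
    rw [holds_and, holds_not, holds_not, e1, e2, h10, h19, c₂.reg_k, Success]
    simp only [hD, not_false_eq_true, true_and, not_not, Nat.sub_eq_zero_iff_le]
  rw [attemptCmd, sem_ite_of_not_holds (hmem.not.2 hD)]
  change Inv E n m k ((ite (and (not (var 10)) (not (sub (var 19) (var 4)))) emitCmd skip).sem σ₂) ∧
    ((_ ∧ supp n (((ite (and (not (var 10)) (not (sub (var 19) (var 4)))) emitCmd skip).sem σ₂).arr 2)
      = _) ∨ (_ ∧ _ ⊂
      supp n (((ite (and (not (var 10)) (not (sub (var 19) (var 4)))) emitCmd skip).sem σ₂).arr 2)))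
  by_cases hs : Success E m k (supp n (σ.arr 2)) (σ.reg 7) (σ.reg 8)
  · rw [sem_ite_of_holds (hcond.2 hs)]
    obtain ⟨L, hL, hLout⟩ := h.2
    obtain ⟨l, hl, hlout, hl2⟩ := emitCmd_spec c₂
    have hnest := search_sound h.1.subset hv hD hs.2.1
    rw [h3] at hl hl2
    rw [h2, ← hl] at hl2
    rw [← hl] at hnest
    rw [hl2]
    refine ⟨⟨c₂.sem rfl, L ++ [l], ?_, ?_⟩, Or.inr ⟨hs, ?_⟩⟩
    · rw [hl2]
      exact hL.snoc hnest (by rw [hl]; exact hs.2.2)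
    · rw [hlout, hout, hLout]
      simp
    · refine ⟨subset_union_left, fun hsub => ?_⟩
      obtain ⟨v, hv⟩ := hnest.1
      exact (mem_sdiff.1 (hnest.2.1 hv)).2 (hsub (mem_union_right _ hv))
  · rw [sem_ite_of_not_holds (hcond.not.2 hs)]
    refine ⟨⟨c₂, ?_⟩, Or.inl ⟨hs, ?_⟩⟩
    · change ∃ L, Elimination E n m k L (supp n (σ₂.arr 2)) ∧ σ₂.output = _
      rw [h2, hout]
      exact h.2
    · change supp n (σ₂.arr 2) = _
      rw [h2]

/-- Compared with the deleted set `D`, nothing has changed because all searches covered by `P`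
have failed, or some vertices have been deleted, which shows that not all searches fail. -/
def Progress (E : ℕ → Finset ℕ) (n m k : ℕ) (D : Finset ℕ) (P : Prop) (σ : State) : Prop :=
  (P ∧ supp n (σ.arr 2) = D) ∨ (¬ Stuck E n m k D ∧ D ⊂ supp n (σ.arr 2))

/-- Failures are recorded for the fixed set `D`, which is valid as long as nothing has been deleted.
After the first success the second alternative of `Progress` persists, because the deleted set only
grows. -/
theorem wordLoop_spec (h : Inv E n m k σ) {D : Finset ℕ} {v : ℕ} (hv : v < n)
    (h7 : σ.reg 7 = v) {P : Prop} (hP : Progress E n m k D P σ) :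
    Inv E n m k ((Cmd.forLt 8 5 attemptCmd).sem σ) ∧
      Progress E n m k D (P ∧ ∀ b < 2 ^ k, ¬ Success E m k D v b)
        ((Cmd.forLt 8 5 attemptCmd).sem σ) := by
  have hpow := h.1.reg_pow
  rw [← hpow]
  refine forLt_induction (fun j τ => Inv E n m k τ ∧
    Progress E n m k D (P ∧ ∀ b < j, ¬ Success E m k D v b) τ)
    ⟨h.setReg (by decide), hP.imp_left fun hP => ⟨⟨hP.1, by simp⟩, hP.2⟩⟩ ?_
  rintro j hj τ ⟨hτ, hprog⟩ hi hr ha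
  have h7τ : τ.reg 7 = v := (hr 7 rfl).trans h7
  obtain ⟨h1, h2⟩ := attemptCmd_spec hτ (by rwa [h7τ])
  rw [h7τ, hi] at h2
  refine ⟨h1.setReg (by decide), ?_⟩
  rcases hprog with ⟨⟨hP, hb⟩, hD⟩ | ⟨hS, hD⟩
  · rw [hD] at h2
    rcases h2 with h2 | h2
    · refine Or.inl ⟨⟨hP, fun b hbj => ?_⟩, h2.2⟩
      rcases Nat.lt_succ_iff_lt_or_eq.1 hbj with hbj | rfl
      exacts [hb b hbj, h2.1]
    · exact Or.inr ⟨fun hS => hS v hv j (by rwa [← hpow]) h2.1, h2.2⟩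
  · refine Or.inr ⟨hS, hD.trans_subset ?_⟩
    rcases h2 with h2 | h2
    · exact h2.2.ge
    · exact h2.2.subset

theorem vertexLoop_spec (h : Inv E n m k σ) :
    Inv E n m k ((Cmd.forLt 7 2 (.forLt 8 5 attemptCmd)).sem σ) ∧
      Progress E n m k (supp n (σ.arr 2)) (Stuck E n m k (supp n (σ.arr 2)))
        ((Cmd.forLt 7 2 (.forLt 8 5 attemptCmd)).sem σ) := by
  have hn := h.1.reg_n
  have := forLt_induction (i := 7) (b := 2) (p := .forLt 8 5 attemptCmd) (σ := σ)
    (fun j τ => Inv E n m k τ ∧ Progress E n m k (supp n (σ.arr 2))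
      (∀ v < j, ∀ b < 2 ^ k, ¬ Success E m k (supp n (σ.arr 2)) v b) τ)
    ⟨h.setReg (by decide), Or.inl ⟨by simp, rfl⟩⟩ ?_
  · rwa [hn] at this
  · rintro j hj τ ⟨hτ, hprog⟩ hi hr ha
    obtain ⟨h1, h2⟩ := wordLoop_spec hτ (by rwa [← hn]) hi hprog
    refine ⟨h1.setReg (by decide), h2.imp_left fun h2 => ⟨fun v hv => ?_, h2.2⟩⟩
    rcases Nat.lt_succ_iff_lt_or_eq.1 hv with hv | rfl
    exacts [h2.1.1 v hv, h2.1.2]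

/-- After `j` sweeps at least `j` vertices are deleted or the search is stuck; a sweep started in a
stuck state changes nothing. -/
theorem eliminateCmd_spec (h : Inv E n m k σ) :
    Inv E n m k (eliminateCmd.sem σ) ∧
      (supp n ((eliminateCmd.sem σ).arr 2) = range n ∨
        Stuck E n m k (supp n ((eliminateCmd.sem σ).arr 2))) := by
  have hn := h.1.reg_n
  obtain ⟨h1, h2⟩ := forLt_induction (i := 6) (b := 2) (p := .forLt 7 2 (.forLt 8 5 attemptCmd)) (σ := σ)
    (fun j τ => Inv E n m k τ ∧ (j ≤ (supp n (τ.arr 2)).card ∨ Stuck E n m k (supp n (τ.arr 2))))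
    ⟨h.setReg (by decide), Or.inl (Nat.zero_le _)⟩ (by
      rintro j hj τ ⟨hτ, hprog⟩ hi hr ha
      obtain ⟨h1, h2⟩ := vertexLoop_spec hτ
      refine ⟨h1.setReg (by decide), ?_⟩
      rw [State.arr_setReg]
      rcases h2 with ⟨hS, hD⟩ | ⟨hS, hD⟩
      · rw [hD]
        exact Or.inr hS
      · have := card_lt_card hD
        have := hprog.resolve_right hS
        left
        omega)
  refine ⟨h1, h2.imp_left fun h2 => ?_⟩
  rw [hn] at h2
  exact eq_of_subset_of_card_le (filter_subset _ _) (by rwa [card_range])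

theorem answerCmd_spec (h : Inv E n m k σ) :
    ((supp n (σ.arr 2) = range n ∧ (n = 0 → m = 0)) ∧
      ∃ L, Elimination E n m k L (range n) ∧ (answerCmd.sem σ).output =
        1 :: (L.map fun l => l.map (· + 1) ++ [0]).flatten) ∨
    (¬ (supp n (σ.arr 2) = range n ∧ (n = 0 → m = 0)) ∧ (answerCmd.sem σ).output = [0]) := by
  let σ₁ := (any 15 14 2 (not (load 2 (var 14)))).sem σ
  have c₁ : Ctx E n m k σ₁ := h.1.sem rfl
  have h15 : σ₁.reg 15 ≠ 0 ↔ ∃ v < n, v ∉ supp n (σ.arr 2) := by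
    rw [← h.1.reg_n]
    refine any_spec (by decide) (by decide) fun ρ hr ha hv => ?_
    rw [holds_not, mem_supp]
    simp [hv, Holds, eval, ha]
  have hcond : (add (var 15) (and (var 3) (not (var 2)))).Holds σ₁ ↔
      ¬ (supp n (σ.arr 2) = range n ∧ (n = 0 → m = 0)) := by
    have e1 : (var 15).Holds σ₁ ↔ σ₁.reg 15 ≠ 0 := Iff.rfl
    have e2 : (var 3).Holds σ₁ ↔ σ₁.reg 3 ≠ 0 := Iff.rfl
    have e3 : (var 2).Holds σ₁ ↔ σ₁.reg 2 ≠ 0 := Iff.rfl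
    rw [holds_add, holds_and, holds_not, e1, e2, e3, h15, c₁.reg_n, c₁.reg_m, not_and_or]
    refine or_congr ?_ (by tauto)
    rw [← not_iff_not]
    push Not
    refine ⟨fun hall => (filter_subset _ _).antisymm fun v hv => hall v (mem_range.1 hv), fun heq v hv => ?_⟩
    rw [heq]
    exact mem_range.2 hv
  have hsem : answerCmd.sem σ = (ite (add (var 15) (and (var 3) (not (var 2))))
      (seq (store 1 (const 0) (const 0)) (assign 1 (const 1)))
      (store 1 (const 0) (const 1))).sem σ₁ := rfl
  by_cases hgood : supp n (σ.arr 2) = range n ∧ (n = 0 → m = 0)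
  · refine Or.inl ⟨hgood, ?_⟩
    obtain ⟨L, hL, hout⟩ := h.2
    rw [hgood.1] at hL
    refine ⟨L, hL, ?_⟩
    have hout₁ : σ₁.output = σ.output := output_congr (sem_reg _ _ rfl) (sem_arr _ _ rfl)
    rw [hsem, sem_ite_of_not_holds (fun hc => hcond.1 hc hgood)]
    rw [hout, State.output] at hout₁
    -- The output is non-empty because of the reserved cell; only that cell is overwritten and the
    -- rest remains.
    obtain ⟨r, hr⟩ : ∃ r, σ₁.reg 1 = r + 1 := by
      refine Nat.exists_eq_succ_of_ne_zero fun h0 => ?_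
      simp [h0] at hout₁
    rw [hr, List.range_succ_eq_map, List.map_cons, List.map_map, List.cons.injEq] at hout₁
    rw [State.output, ← hout₁.2]
    simp only [sem, State.reg_setArr, hr, List.range_succ_eq_map, List.map_cons, List.map_map]
    congr 1
  · refine Or.inr ⟨hgood, ?_⟩
    rw [hsem, sem_ite_of_holds (hcond.2 hgood)]
    simp [State.output, sem, eval, List.range_succ]

/-! Initialization. -/

/-- The initial output length `1` reserves the verdict cell, which holds `0`. The offset `3 + n`
skips the header and the characteristic vector of `V(H)`. -/
def readCmd : Cmd :=
  seq (seq (assign 2 (load 0 (const 1))) (assign 3 (load 0 (const 2))))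
    (seq (assign 4 (load 0 (const 0)))
      (seq (seq (assign 1 (const 1)) (assign 5 (const 1))) (assign 20 (add (const 3) (var 2)))))

/-- Without multiplication, `2 ^ k` arises by doubling and the positions of the edges by repeated
addition of `n`. -/
def prepareCmd : Cmd :=
  seq (.forLt 11 4 (assign 5 (add (var 5) (var 5))))
    (.forLt 12 3 (seq (store 4 (var 12) (var 20)) (assign 20 (add (var 20) (var 2)))))

theorem prepareCmd_spec (h2 : σ.reg 2 = n) (h3 : σ.reg 3 = m) (h4 : σ.reg 4 = k)
    (h5 : σ.reg 5 = 1) (h20 : σ.reg 20 = 3 + n) :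
    (prepareCmd.sem σ).reg 5 = 2 ^ k ∧
      ∀ e < m, (prepareCmd.sem σ).arr 4 e = 3 + n + e * n := by
  let σ₁ := (Cmd.forLt 11 4 (assign 5 (add (var 5) (var 5)))).sem σ
  have hpow : σ₁.reg 5 = 2 ^ k := by
    rw [← h4]
    refine forLt_induction (fun j τ => τ.reg 5 = 2 ^ j) (by simp [h5]) ?_
    intro j hj τ hI hi hr ha
    simp only [sem, State.reg_setReg, eval, hI]
    norm_num
    ring
  have e2 : σ₁.reg 2 = n := (sem_reg _ _ rfl).trans h2
  have e3 : σ₁.reg 3 = m := (sem_reg _ _ rfl).trans h3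
  have e20 : σ₁.reg 20 = 3 + n := (sem_reg _ _ rfl).trans h20
  refine ⟨(sem_reg _ σ₁ rfl).trans hpow, ?_⟩
  rw [← e3]
  refine (forLt_induction (i := 12) (b := 3) (σ := σ₁)
    (p := seq (store 4 (var 12) (var 20)) (assign 20 (add (var 20) (var 2))))
    (fun j τ => τ.reg 20 = 3 + n + j * n ∧ ∀ e < j, τ.arr 4 e = 3 + n + e * n)
    (by simp [e20]) ?_).2
  rintro j hj τ ⟨hI, hI'⟩ hi hr ha
  have hr2 : τ.reg 2 = n := (hr 2 rfl).trans e2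
  refine ⟨?_, fun e he => ?_⟩
  · simp [sem, eval, hI, hr2]
    ring
  · simp only [sem, State.arr_setReg, State.arr_setArr, eval, hi, hI, true_and]
    split_ifs with heq
    · rw [heq]
    · exact hI' e (by omega)

end NestSearch

theorem List.getD_flatten_of_forall_length_eq {α : Type*} {n : ℕ} {L : List (List α)} (d : α)
    (hL : ∀ l ∈ L, l.length = n) (i : ℕ) {v : ℕ} (hv : v < n) :
    L.flatten.getD (i * n + v) d = (L.getD i []).getD v d := by
  induction L generalizing i with
  | nil => simp
  | cons l L ih =>
    have hl := hL l List.mem_cons_self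
    rw [List.flatten_cons]
    cases i with
    | zero => rw [List.getD_append _ _ _ _ (by omega)]; simp
    | succ i =>
      have h : (i + 1) * n + v = l.length + (i * n + v) := by rw [hl]; ring
      rw [h, List.getD_append_right _ _ _ _ (by omega), Nat.add_sub_cancel_left,
        ih fun l hl => hL l (List.mem_cons_of_mem _ hl)]
      simp

/-! ### The input word and the complete program. -/

namespace NSWInstance

open Finset NestSearch RAM ForLang

variable (x : NSWInstance.{u})

theorem n_eq : x.n = x.H.vertexSet.ncard := by
  rw [← Nat.card_coe_set_eq, ← Nat.card_congr x.vert, Nat.card_eq_fintype_card, Fintype.card_fin]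

theorem m_eq : x.m = x.H.edgeSet.ncard := by
  rw [← Nat.card_coe_set_eq, ← Nat.card_congr x.edge, Nat.card_eq_fintype_card, Fintype.card_fin]

theorem length_charVec (s : Set x.α) : (x.charVec s).length = x.n := by simp [charVec]

theorem length_encode : x.encode.length = 3 + x.n + x.m * x.n := by
  have h : ∀ L : List (List ℕ), (∀ l ∈ L, l.length = x.n) → L.flatten.length = L.length * x.n := by
    intro L hL
    rw [List.length_flatten, List.map_congr_left hL]
    simp
  rw [encode, List.length_append, List.length_append, length_charVec, h]
  · simp
  · intro l hl
    obtain ⟨j, rfl⟩ := List.mem_ofFn.1 hl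
    exact x.length_charVec _

theorem encode_getD_edge {e v : ℕ} (he : e < x.m) (hv : v < x.n) :
    x.encode.getD (3 + x.n + e * x.n + v) 0 ≠ 0 ↔ v ∈ x.edgeIndices e := by
  have hlen : ([x.k, x.n, x.m] ++ x.charVec x.H.vertexSet).length = 3 + x.n := by
    simp [length_charVec]; omega
  rw [encode, add_assoc, List.getD_append_right _ _ _ _ (by omega), hlen, Nat.add_sub_cancel_left,
    List.getD_flatten_of_forall_length_eq (n := x.n) _ _ _ hv]
  · have hmem := mem_indices (s := (x.edge ⟨e, he⟩ : Set x.α)) ⟨v, hv⟩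
    dsimp only at hmem
    rw [edgeIndices, dif_pos he, hmem]
    simp [List.getD, charVec, he, hv]
  · intro l hl
    obtain ⟨j, rfl⟩ := List.mem_ofFn.1 hl
    exact x.length_charVec _

theorem encode_header : x.encode.getD 0 0 = x.k ∧ x.encode.getD 1 0 = x.n ∧
    x.encode.getD 2 0 = x.m := ⟨rfl, rfl, rfl⟩

/-- For `n > 0` each edge contributes at least one entry; for `n = 0` the only possible edge is `∅`,
and the header makes up for it. -/
theorem size_le_length : x.n + x.m + 1 ≤ x.encode.length := by
  rw [length_encode]
  rcases Nat.eq_zero_or_pos x.n with hn | hn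
  · have hm : x.m ≤ 1 := by
      have hempty : ∀ s : Set x.α, s ⊆ x.H.vertexSet → s = ∅ := fun s hs => by
        refine Set.eq_empty_iff_forall_notMem.2 fun v hv => ?_
        have := (x.vert.symm ⟨v, hs hv⟩).2
        omega
      have hsub : Subsingleton (Fin x.m) := by
        refine ⟨fun i j => x.edge.injective (Subtype.ext ?_)⟩
        rw [hempty _ (x.H.subset_vertexSet_of_mem_edgeSet' (x.edge i).2),
          hempty _ (x.H.subset_vertexSet_of_mem_edgeSet' (x.edge j).2)]
      exact Fin.subsingleton_iff_le_one.1 hsub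
    omega
  · have : x.m ≤ x.m * x.n := Nat.le_mul_of_pos_right _ hn
    omega

variable {x}

theorem _root_.NestSearch.Elimination.partialNEO {L : List (List ℕ)} {D : Finset ℕ} {k : ℕ}
    (h : Elimination x.edgeIndices x.n x.m k L D) :
    x.H.PartialNEO k (L.map fun l => x.toSet l.toFinset) (x.toSet D) := by
  induction h with
  | nil =>
    have : x.toSet ∅ = ∅ := by simp [toSet]
    rw [this]
    exact .nil
  | @snoc L D l h hnest hk ih =>
    have hunion : x.toSet (D ∪ l.toFinset) = x.toSet D ∪ x.toSet l.toFinset := by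
      ext v
      simp only [toSet, Finset.mem_union, Set.mem_ofPred_eq, Set.mem_union, or_and_right, exists_or]
    have hsub : l.toFinset ⊆ range x.n := hnest.2.1.trans sdiff_subset
    rw [hunion, List.map_append]
    refine ih.snoc ((isNestSet_delete_toSet_iff hsub).2 hnest) ?_
    rw [encard_toSet hsub]
    exact_mod_cast hk

theorem _root_.NestSearch.Elimination.lt {L : List (List ℕ)} {D : Finset ℕ} {E : ℕ → Finset ℕ}
    {n m k : ℕ} (h : Elimination E n m k L D) : ∀ l ∈ L, ∀ i ∈ l, i < n := by
  induction h with
  | nil => simp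
  | snoc h hnest hk ih =>
    intro l hl i hi
    rcases List.mem_append.1 hl with hl | hl
    · exact ih l hl i hi
    · rw [List.mem_singleton.1 hl] at hi
      exact mem_range.1 (mem_sdiff.1 (hnest.2.1 (List.mem_toFinset.2 hi))).1

theorem represents {L : List (List ℕ)} (hL : ∀ l ∈ L, ∀ i ∈ l, i < x.n) :
    x.Represents (L.map fun l => l.map (· + 1) ++ [0]).flatten
      (L.map fun l => x.toSet l.toFinset) := by
  have hlift : ∃ L' : List (List (Fin x.n)), L'.map (List.map Fin.val) = L := by
    refine ⟨L.pmap (fun l hl => l.pmap (fun i hi => ⟨i, hi⟩) hl) hL, ?_⟩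
    simp [List.map_pmap, List.pmap_eq_map]
  obtain ⟨L', rfl⟩ := hlift
  refine ⟨L', ?_, ?_⟩
  · rw [List.map_map]
    refine congrArg List.flatten (List.map_congr_left fun l _ => ?_)
    change List.map _ (l.map Fin.val) ++ [0] =
      List.map (fun i => i + 1) (l.flatMap fun a : Fin x.n => [a.val]) ++ [0]
    rw [← List.map_eq_flatMap]
  · rw [List.map_map]
    refine List.map_congr_left fun l _ => ?_
    ext v
    simp only [Function.comp_apply, toSet, List.mem_toFinset, List.mem_map, Fin.val_inj,
      exists_eq_right, Set.mem_ofPred_eq]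

theorem eq_bot_of_m_eq_zero (hn : x.n = 0) (hm : x.m = 0) : x.H = ⊥ := by
  refine Hypergraph.ext (Set.eq_empty_iff_forall_notMem.2 fun v hv => ?_)
    (Set.eq_empty_iff_forall_notMem.2 fun e he => ?_)
  · have := (x.vert.symm ⟨v, hv⟩).2
    omega
  · have := (x.edge.symm ⟨e, he⟩).2
    omega

/-- The program that eliminates nest-sets of the input hypergraph as long as possible. -/
def _root_.NestSearch.prog : Prog :=
  .seq (readCmd.compile 21) (.seq (prepareCmd.compile 21)
    (.seq (eliminateCmd.compile 21) (answerCmd.compile 21)))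

def _root_.NestSearch.progCost (B : ℕ) : ℕ :=
  readCmd.cost B + (prepareCmd.cost B + (eliminateCmd.cost B + answerCmd.cost B))

theorem runs_prog (x : NSWInstance.{u}) : ∃ (t : ℕ) (y : List ℕ),
    prog.Computes x.encode t y ∧ t ≤ progCost (2 ^ x.k + x.n + x.m) ∧
    ((∃ (w : List ℕ) (O : List (Set x.α)),
      y = 1 :: w ∧ x.Represents w O ∧ x.H.IsKNEO x.k O) ∨
    (y = [0] ∧ ¬ x.H.nsw ≤ (x.k : ℕ∞))) := by
  set B := 2 ^ x.k + x.n + x.m with hB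
  let σ₀ := State.init x.encode
  let σ₁ := readCmd.sem σ₀
  let σ₂ := prepareCmd.sem σ₁
  let σ₃ := eliminateCmd.sem σ₂
  obtain ⟨hk, hn, hm⟩ := x.encode_header
  have r2 : σ₁.reg 2 = x.n := hn
  have r3 : σ₁.reg 3 = x.m := hm
  have r4 : σ₁.reg 4 = x.k := hk
  have r5 : σ₁.reg 5 = 1 := rfl
  have r20 : σ₁.reg 20 = 3 + x.n := congrArg (3 + ·) hn
  obtain ⟨hpow, hoff⟩ := prepareCmd_spec r2 r3 r4 r5 r20
  have ctx : Ctx x.edgeIndices x.n x.m x.k σ₂ := by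
    refine ⟨(Cmd.sem_reg _ _ rfl).trans r2, (Cmd.sem_reg _ _ rfl).trans r3,
      (Cmd.sem_reg _ _ rfl).trans r4, hpow, fun e he v hv => ?_, fun e _ => edgeIndices_subset e⟩
    rw [hoff e he, ← encode_getD_edge x he hv]
    have : σ₂.arr 0 = σ₀.arr 0 := (Cmd.sem_arr _ _ rfl).trans (Cmd.sem_arr _ _ rfl)
    rw [this]
    rfl
  have inv : Inv x.edgeIndices x.n x.m x.k σ₂ := by
    refine ⟨ctx, [], ?_, ?_⟩
    · have : σ₂.arr 2 = σ₀.arr 2 := (Cmd.sem_arr _ _ rfl).trans (Cmd.sem_arr _ _ rfl)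
      have : supp x.n (σ₂.arr 2) = ∅ := by
        rw [this]
        simp [supp, σ₀, State.init]
      rw [this]
      exact .nil
    · rw [output_congr (σ := σ₁) (Cmd.sem_reg _ _ rfl) (Cmd.sem_arr _ _ rfl)]
      rfl
  obtain ⟨inv₃, hfin⟩ := eliminateCmd_spec inv
  have hkpow : x.k < 2 ^ x.k := Nat.lt_two_pow_self
  -- The phases are compiled separately because their protected registers differ: reading sets the
  -- registers `2` to `4`, preparation sets `5`, and afterwards all four stay fixed.
  obtain ⟨t₁, τ₁, run₁, l₁, a₁⟩ := readCmd.runs_compile (K := 21) (B := B) (R := []) rfl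
    (σ := σ₀) (τ := σ₀) ⟨fun _ _ => rfl, rfl⟩ (by simp)
  obtain ⟨t₂, τ₂, run₂, l₂, a₂⟩ := prepareCmd.runs_compile (K := 21) (B := B) (R := [3, 4]) rfl
    a₁ (by
      intro r hr
      change σ₁.reg r ≤ B
      simp only [List.mem_cons, List.not_mem_nil, or_false] at hr
      rcases hr with rfl | rfl
      · rw [r3]; omega
      · rw [r4]; omega)
  have hbound : ∀ σ, Ctx x.edgeIndices x.n x.m x.k σ → ∀ r ∈ [2, 3, 4, 5], σ.reg r ≤ B := by
    intro σ hσ r hr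
    simp only [List.mem_cons, List.not_mem_nil, or_false] at hr
    rcases hr with rfl | rfl | rfl | rfl
    · rw [hσ.reg_n]; omega
    · rw [hσ.reg_m]; omega
    · rw [hσ.reg_k]; omega
    · rw [hσ.reg_pow]; omega
  obtain ⟨t₃, τ₃, run₃, l₃, a₃⟩ := eliminateCmd.runs_compile (K := 21) (B := B)
    (R := [2, 3, 4, 5]) rfl a₂ (hbound _ ctx)
  obtain ⟨t₄, τ₄, run₄, l₄, a₄⟩ := answerCmd.runs_compile (K := 21) (B := B)
    (R := [2, 3, 4, 5]) rfl a₃ (hbound _ inv₃.1)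
  refine ⟨_, _, ⟨τ₄, .seq run₁ (.seq run₂ (.seq run₃ run₄)), rfl⟩,
    add_le_add l₁ (add_le_add l₂ (add_le_add l₃ l₄)), ?_⟩
  rw [output_congr (a₄.1 1 (by decide)) (by rw [a₄.2])]
  rcases answerCmd_spec inv₃ with ⟨⟨hall, hnm⟩, L, hL, hout⟩ | ⟨hbad, hout⟩
  · left
    refine ⟨_, _, hout, represents hL.lt, hL.partialNEO.isKNEO ?_ ?_⟩
    · intro v hv
      obtain ⟨i, hi⟩ := x.vert.surjective ⟨v, hv⟩
      exact ⟨i, mem_range.2 i.2, by rw [hi]⟩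
    -- If nothing was eliminated although all vertices are gone, then `n = 0`, and acceptance also
    -- gives `m = 0`.
    · by_cases hLn : L = []
      · right
        subst hLn
        have hn0 : x.n = 0 := by
          generalize hL' : ([] : List (List ℕ)) = L at hL
          generalize hD : range x.n = D at hL
          cases hL with
          | nil => simpa using hD
          | snoc => simp at hL'
        exact eq_bot_of_m_eq_zero hn0 (hnm hn0)
      · left
        simpa using hLn
  · right
    refine ⟨hout, ?_⟩
    rw [Hypergraph.nsw_le_iff]
    rintro ⟨O, hO⟩
    -- Rejection with no vertex left means `n = 0` and `m ≠ 0`. Then `H ≠ ⊥` excludes the empty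
    -- ordering, and the lack of vertices excludes a first nest-set.
    by_cases hall : supp x.n (σ₃.arr 2) = range x.n
    · have hnm : x.n = 0 ∧ x.m ≠ 0 := by
        by_contra hcon
        exact hbad ⟨hall, fun h => by_contra fun h' => hcon ⟨h, h'⟩⟩
      have hV : x.H.vertexSet = ∅ := Set.eq_empty_iff_forall_notMem.2 fun v hv => by
        have := (x.vert.symm ⟨v, hv⟩).2
        omega
      cases O with
      | nil =>
        have he := (x.edge ⟨0, by omega⟩).2
        have hE : x.H.edgeSet = ∅ := congrArg Hypergraph.edgeSet (show x.H = ⊥ from hO.1)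
        exact Set.notMem_empty _ (hE.subset he)
      | cons s O =>
        have hs : x.H.IsNestSet s := hO.1.1
        have := hs.2.1
        rw [hV] at this
        exact hs.1.not_subset_empty this
    -- Otherwise the search is stuck with a vertex left, while a `k`-NEO would supply a small
    -- nest-set there.
    · have hstuck := hfin.resolve_left hall
      obtain ⟨v, hv, hvD⟩ : ∃ v ∈ range x.n, v ∉ supp x.n (σ₃.arr 2) := by
        by_contra! hcon
        exact hall ((filter_subset _ _).antisymm hcon)
      obtain ⟨s, hs, hsk⟩ := hO.exists_isNestSet_delete (X := x.toSet (supp x.n (σ₃.arr 2)))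
        ⟨x.vert ⟨v, mem_range.1 hv⟩, (x.vert _).2, by rwa [vert_mem_toSet]⟩
      have hsV : s ⊆ x.H.vertexSet := hs.2.1.trans Set.sdiff_subset
      rw [← toSet_indices hsV] at hs hsk
      rw [isNestSet_delete_toSet_iff (indices_subset s)] at hs
      rw [encard_toSet (indices_subset s)] at hsk
      have h1 := hstuck.not_isNest hs
      have h2 : (x.indices s).card ≤ x.k := by exact_mod_cast hsk
      omega

end NSWInstance

/-! ### The running time in terms of `k` and the size. -/

namespace NestSearch

open RAM ForLang

theorem progCost_le : ∃ C d : ℕ, ∀ B, progCost B ≤ C * (B + 1) ^ d := by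
  obtain ⟨C, d, h⟩ := Cmd.cost_le
    (.seq readCmd (.seq prepareCmd (.seq eliminateCmd answerCmd)))
  exact ⟨C, d, h⟩

/-- Separates the factor that depends on the parameter from the one that depends on the size. -/
theorem pow_sum_le (k s d : ℕ) : (2 ^ k + s + 1) ^ d ≤ (2 ^ (k + 1)) ^ d * (s + 1) ^ d := by
  rw [← mul_pow]
  refine Nat.pow_le_pow_left ?_ d
  have h : 1 ≤ 2 ^ k := Nat.one_le_two_pow
  calc 2 ^ k + s + 1 ≤ 2 ^ k * (s + 1) + 2 ^ k * (s + 1) := by nlinarith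
    _ = 2 ^ (k + 1) * (s + 1) := by ring

end NestSearch

/-- Deciding `nsw H ≤ k` is fixed-parameter tractable in `k`; moreover, a program running in time
`2 ^ O(k ^ 2) * poly ‖H‖` outputs a `k`-NEO of `H` if `nsw H ≤ k`, and rejects otherwise. -/
theorem corollary5p7 :
    NSWProblem.{u}.IsFPT ∧
    ∃ (p : RAM.Prog) (c : ℕ), ∀ x : NSWInstance.{u}, ∃ (t : ℕ) (y : List ℕ),
      p.Computes x.encode t y ∧
      t ≤ c * 2 ^ (c * x.k ^ 2) * (x.H.size + 1) ^ c ∧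
      (x.H.nsw ≤ (x.k : ℕ∞) →
        ∃ (w : List ℕ) (O : List (Set x.α)),
          y = 1 :: w ∧ x.Represents w O ∧ x.H.IsKNEO x.k O) ∧
      (¬ x.H.nsw ≤ (x.k : ℕ∞) → y = [0]) := by
  obtain ⟨C, d, hC⟩ := NestSearch.progCost_le
  have htime : ∀ (x : NSWInstance.{u}) (t : ℕ), t ≤ NestSearch.progCost (2 ^ x.k + x.n + x.m) →
      t ≤ C * ((2 ^ (x.k + 1)) ^ d * (x.n + x.m + 1) ^ d) := by
    intro x t ht
    refine ht.trans ((hC _).trans (Nat.mul_le_mul_left _ ?_))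
    rw [add_assoc (2 ^ x.k)]
    exact NestSearch.pow_sum_le x.k (x.n + x.m) d
  -- For the decision version the output is cut down to its first cell by setting its length to `1`;
  -- `C + 1` pays for this extra step. In the second part the constant `C * 2 ^ d + d` dominates the
  -- factor `C * 2 ^ d` and both exponents `d`.
  refine ⟨⟨.seq NestSearch.prog (.const 1 1), fun k => (C + 1) * (2 ^ (k + 1)) ^ d, d, ?_, ?_⟩,
    NestSearch.prog, C * 2 ^ d + d, ?_⟩
  · have hpow : Primrec₂ (fun a b : ℕ => a ^ b) := Primrec₂.unpaired'.1 Nat.Primrec.pow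
    exact (Primrec.nat_mul.comp (Primrec.const (C + 1)) (hpow.comp
      (hpow.comp (Primrec.const 2) Primrec.succ) (Primrec.const d))).to_comp
  · intro (x : NSWInstance.{u})
    obtain ⟨t, y, ⟨τ, hrun, rfl⟩, ht, hy⟩ := x.runs_prog
    refine ⟨_, _, ⟨_, .seq hrun (.const 1 1 τ), rfl⟩, ?_, ?_⟩
    · have hlen := x.size_le_length
      have h1 : 1 ≤ (2 ^ (x.k + 1)) ^ d * x.encode.length ^ d :=
        Nat.mul_pos (by positivity) (pow_pos (by omega) d)
      calc t + 1 ≤ C * ((2 ^ (x.k + 1)) ^ d * x.encode.length ^ d) +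
            (2 ^ (x.k + 1)) ^ d * x.encode.length ^ d := by
            refine add_le_add ((htime x t ht).trans ?_) h1
            gcongr
        _ = (C + 1) * (2 ^ (x.k + 1)) ^ d * x.encode.length ^ d := by ring
    · have hout : ∀ {c : ℕ} {w : List ℕ}, τ.output = c :: w →
          (τ.setReg 1 1).output = [c] := by
        intro c w h
        have h0 : τ.reg 1 ≠ 0 := fun h0 => by simp [RAM.State.output, h0] at h
        obtain ⟨r, hr⟩ := Nat.exists_eq_succ_of_ne_zero h0
        rw [RAM.State.output, hr, List.range_succ_eq_map, List.map_cons, List.cons.injEq] at h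
        simp [RAM.State.output, List.range_succ, h.1]
      rcases hy with ⟨w, O, hy, -, hO⟩ | ⟨hy, hno⟩
      · exact ⟨fun _ => hout hy, fun hno => absurd (Hypergraph.nsw_le_iff.2 ⟨O, hO⟩) hno⟩
      · exact ⟨fun hyes => absurd hyes hno, fun _ => hout hy⟩
  · intro x
    obtain ⟨t, y, hcomp, ht, hy⟩ := x.runs_prog
    refine ⟨t, y, hcomp, ?_, ?_⟩
    · have hsize : x.H.size = x.n + x.m := by rw [Hypergraph.size, ← x.n_eq, ← x.m_eq]
      rw [hsize]
      calc t ≤ C * ((2 ^ (x.k + 1)) ^ d * (x.n + x.m + 1) ^ d) := htime x t ht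
        _ = C * 2 ^ d * 2 ^ (d * x.k) * (x.n + x.m + 1) ^ d := by ring
        _ ≤ (C * 2 ^ d + d) * 2 ^ ((C * 2 ^ d + d) * x.k ^ 2) *
            (x.n + x.m + 1) ^ (C * 2 ^ d + d) := by
          refine Nat.mul_le_mul (Nat.mul_le_mul (by omega) (Nat.pow_le_pow_right (by omega) ?_))
            (Nat.pow_le_pow_right (by omega) (by omega))
          -- The time obtained is `2 ^ (d * k)` in `k`; the bound by `k ^ 2` only uses `k ≤ k ^ 2`.
          exact Nat.mul_le_mul (by omega) (Nat.le_self_pow (by omega) _)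
    · rcases hy with hy | ⟨hy, hno⟩
      · obtain ⟨w, O, -, -, hO⟩ := id hy
        exact ⟨fun _ => hy, fun hno => absurd (Hypergraph.nsw_le_iff.2 ⟨O, hO⟩) hno⟩
      · exact ⟨fun hyes => absurd hyes hno, fun _ => hy⟩
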